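/- **Theorem 2.2.** Fix $n\ge 1$ and consider the focusing vector nonlinear Schrödinger equation (the Manakov model for $n=2$) $iR_t+R_{xx}+2RR^\dagger R=0$ for $R(x,t)\in\mathbb C^n$. *The $N$-soliton solution.* Let $k_1,\dots,k_N\in\mathbb C$ with $k_j=\tfrac12(u_j+iv_j)$, $v_j>0$, $u_1<\dots<u_N$, and let $\beta_1,\dots,\beta_N\in\mathbb C^n\setminus\{0\}$ (norming constants). For a nonzero vector $v$ put $P_v=vv^\dagger/(v^\dagger v)$, and let $f_j(k)=\frac{k-k_j}{k-k_j^*}$. For vectors $v_1,\dots,v_N$ and distinct indices $i_1,\dots,i_\ell$ define recursively $D_\emptyset=I$ and $D_{i_1\dots i_\ell}(k)=D_{i_1\dots i_{\ell-1}}(k)\,\bigl(I+(f_{i_\ell}(k)-1)P_{\zeta}\bigr)$ with $\zeta=D_{i_1\dots i_{\ell-1}}(k_{i_\ell})^\dagger v_{i_\ell}$. Write $d_{i_1\dots i_\ell}$ for the result with $v_j=\beta_j\in\mathbb C^n$, and $D_{i_1\dots i_\ell}(x,t,\cdot)$ for the result with $v_j(x,t)=e^{-i\phi(x,t,k_j^*)\Sigma_3}\binom{\beta_j}{-1}\in\mathbb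 C^{n+1}$, where $\phi(x,t,k)=kx+2k^2t$ and $\Sigma_3=\mathrm{diag}(I_n,-1)$. The $N$-soliton solution $R(x,t)$ is the upper right $n\times1$ block of $$Q=\sum_{j=1}^N i(k_j-k_j^*)[\Sigma_3,\Pi_j],\qquad \Pi_j=P_{\zeta_j},\quad \zeta_j(x,t)=D_{1\dots j-1}(x,t,k_j)^\dagger v_j(x,t).$$ For $b\in\mathbb C^n\setminus\{0\}$ the one-soliton with parameters $(k_j,b)$ is $$\frac{b}{|b|}\,v_j\,\frac{e^{-i(u_jx+(u_j^2-v_j^2)t)}}{\cosh\bigl(v_j(x+2u_jt-v_j^{-1}\ln|b|)\bigr)}.$$ The direction $[b]\in\mathbb{CP}^{n-1}$ is its polarization. *The pairwise collision map.* For $k_1\ne k_2$, $k_1\neq k_2^*$, let $\mathcal R(k_1,k_2)$ be the map of $\mathbb{CP}^{n-1}\times\mathbb{CP}^{n-1}$ to itself sending $([p_1],[p_2])$ to $$\Bigl(\Bigl[\Bigl(I+\Bigl(\tfrac{k_1^*-k_2}{k_1^*-k_2^*}-1\Bigr)P_{p_2}\Bigr)p_1\Bigr],\ \Bigl[\Bigl(I+\Bigl(\tfrac{k_2-k_1^*}{k_2-k_1}-1\Bigr)P_{p_1}\Bigr)p_2\Bigr]\Bigr).$$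 *Arrangements.* An arrangement $\sigma=(i_1,\dots,i_N)$ is a permutation of $1,\dots,N$ (the order of the solitons on the $x$-axis from left to right). In the arrangement $\sigma$ soliton $j=i_a$ is given the norming constant $$\gamma^\sigma_{j}=\prod_{m<a}f_{i_m}(k_{j}^*)\; d_{i_{a+1}\dots i_N}(k_{j})^\dagger\beta_{j}\neq 0$$ and the polarization $p^\sigma_j=[\gamma^\sigma_j]$. A pairwise collision $(j,l)$, $j<l$, can occur in an arrangement where $j$ stands immediately to the left of $l$; it exchanges their places. A collision history is a finite sequence of such collisions starting from the arrangement $(1,2,\dots,N)$; it is complete if it ends in $(N,\dots,2,1)$. *Then:* 1. $\mathcal R$ is a reversible parametric Yang–Baxter map: $\mathcal R_{12}(k_1,k_2)\mathcal R_{13}(k_1,k_3)\mathcal R_{23}(k_2,k_3)=\mathcal R_{23}(k_2,k_3)\mathcal R_{13}(k_1,k_3)\mathcal R_{12}(k_1,k_2)$ on $(\mathbb{CP}^{n-1})^3$ and $\mathcal R_{21}(k_2,k_1)\mathcal R(k_1,k_2)=\mathrm{Id}$, whenever the parameters involved satisfy $k_i\ne k_j$ and $k_i\ne k_j^*$ for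 $i<j$. 2. $R$ is a smooth solution of the equation, and it does not change if the data $(k_j,\beta_j)$ are dressed in another order. 3. There is exactly one family of nonzero vectors $(b_j)$ such that, as $t\to-\infty$, $R(\cdot,t)$ minus the sum of the one-solitons with parameters $(k_j,b_j)$ tends to $0$ uniformly in $x$, namely $b_j=\gamma_j^{(1,\dots,N)}$; likewise as $t\to+\infty$, with $b_j=\gamma_j^{(N,\dots,1)}$. Hence the polarizations before and after the $N$-soliton collision are $p_j^{in}=p_j^{(1,\dots,N)}$ and $p_j^{out}=p_j^{(N,\dots,1)}$. 4. Every pairwise collision acts on the polarizations through $\mathcal R$: if $\sigma'$ arises from an arrangement $\sigma$ by a collision $(j,l)$, then $(p^{\sigma'}_j,p^{\sigma'}_l)=\mathcal R(k_j,k_l)(p^\sigma_j,p^\sigma_l)$ and $p^{\sigma'}_m=p^\sigma_m$ for $m\ne j,l$. 5. The collisions may take place in arbitrary order: every collision history can be continued to a complete one. Every complete collision history consists of exactly $\binom N2$ collisions, one for each pair $j<l$, and the composition, in the order of the history, of the maps $\mathcal R_{jl}(k_j,k_l)$ sends $(p_1^{in},\dots,p_N^{in})$ to $(p_1^{out},\dots,p_N^{out})$.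 -/

import Mathlib

namespace Manakov

open Matrix Filter
open scoped ComplexConjugate

noncomputable section

/-! ### Dressing factors -/

section Dressing

variable {ι : Type*} [Fintype ι] [DecidableEq ι]

/-- Orthogonal projector `v v† / (v† v)` on the line spanned by a nonzero vector `v`. -/
def lineProj (v : ι → ℂ) : Matrix ι ι ℂ :=
  (star v ⬝ᵥ v)⁻¹ • vecMulVec v (star v)

/-- `1 + (c - 1) v v† / (v† v)`: multiplication by `c` on the line of `v`, identity on the
orthogonal complement. -/
def scaleLine (c : ℂ) (v : ι → ℂ) : Matrix ι ι ℂ :=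
  1 + (c - 1) • lineProj v

/-- The scalar `f(z) = (z - k) / (z - k^*)`. -/
def blaschke (k z : ℂ) : ℂ := (z - k) / (z - conj k)

/-- Dressing factor of degree one: `1 + (f(z) - 1) v v† / (v† v)`. -/
def dressFactor (k : ℂ) (v : ι → ℂ) (z : ℂ) : Matrix ι ι ℂ :=
  scaleLine (blaschke k z) v

/-- Dressing factor `D_{i₁ … i_ℓ}(z)` of degree `ℓ` for the list of pairs `(k_i, v_i)`.
Starting from the identity, the pair `(k, v)` multiplies the factor `D` built so far, on the right,
by the degree one factor with parameter `k` and dressed vector `D(k)† v`. -/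
def dress (L : List (ℂ × (ι → ℂ))) : ℂ → Matrix ι ι ℂ :=
  L.foldl (fun D s z => D z * dressFactor s.1 ((D s.1)ᴴ *ᵥ s.2) z) (fun _ => 1)

open scoped ComplexOrder in
lemma lineProj_mul_self (v : ι → ℂ) : lineProj v * lineProj v = lineProj v := by
  by_cases hv : v = 0
  · subst hv; ext i j; simp [lineProj, vecMulVec]
  · have h : star v ⬝ᵥ v ≠ 0 := by simpa using hv
    simp [lineProj, vecMulVec_mul_vecMulVec, smul_smul, h]

lemma scaleLine_mul (c d : ℂ) (v : ι → ℂ) :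
    scaleLine c v * scaleLine d v = scaleLine (c * d) v := by
  simp only [scaleLine, mul_add, add_mul, one_mul, mul_one, smul_mul_smul_comm,
    lineProj_mul_self]
  module

lemma isUnit_scaleLine {c : ℂ} (hc : c ≠ 0) (v : ι → ℂ) : IsUnit (scaleLine c v) :=
  IsUnit.of_mul_eq_one (scaleLine c⁻¹ v) (by
    rw [scaleLine_mul, mul_inv_cancel₀ hc]; simp [scaleLine])

lemma isUnit_dress (L : List (ℂ × (ι → ℂ))) (z : ℂ) (h : ∀ s ∈ L, blaschke s.1 z ≠ 0) :
    IsUnit (dress L z) := by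
  induction L using List.reverseRecOn with
  | nil => simp [dress]
  | append_singleton L s ih =>
    have e : dress (L ++ [s]) z
        = dress L z * dressFactor s.1 ((dress L s.1)ᴴ *ᵥ s.2) z := by
      simp [dress, List.foldl_append]
    rw [e]
    exact (ih fun t ht => h t (by simp [ht])).mul (isUnit_scaleLine (h s (by simp)) _)

lemma scaleLine_smul {a : ℂ} (ha : a ≠ 0) (c : ℂ) (v : ι → ℂ) :
    scaleLine c (a • v) = scaleLine c v := by
  have e : lineProj (a • v) = lineProj v := by
    ext i j
    have h : conj a ≠ 0 := by simpa using ha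
    simp only [lineProj, star_smul, smul_dotProduct, dotProduct_smul, smul_eq_mul, Matrix.smul_apply,
      vecMulVec_apply, Pi.smul_apply, Pi.star_apply]
    simp only [RCLike.star_def, mul_inv]
    field_simp
  rw [scaleLine, scaleLine, e]

end Dressing

/-! ### The vector nonlinear Schroedinger equation and its `N`-soliton solutions -/

/-- Euclidean norm on `ℂⁿ`. -/
def euclNorm {n : ℕ} (v : Fin n → ℂ) : ℝ := Real.sqrt (∑ i, ‖v i‖ ^ 2)

/-- `q` is a smooth solution of `i q_t + q_xx + 2 q q† q = 0` (first argument `x`,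
second argument `t`). -/
def IsVNLSSolution {n : ℕ} (q : ℝ → ℝ → Fin n → ℂ) : Prop :=
  ContDiff ℝ (⊤ : ℕ∞) (fun z : ℝ × ℝ => q z.1 z.2) ∧
  ∀ x t, Complex.I • deriv (fun s => q x s) t + iteratedDeriv 2 (fun y => q y t) x
    + (2 * (star (q x t) ⬝ᵥ q x t)) • q x t = 0

/-- The phase `φ(x, t, k) = k x + 2 k² t`. -/
def phase (x t : ℝ) (k : ℂ) : ℂ := k * x + 2 * k ^ 2 * t

/-- The seed vector `exp(-i φ(x, t, k^*) Σ₃) (β, -1)` in `ℂⁿ⁺¹`. -/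
def seed {n : ℕ} (x t : ℝ) (k : ℂ) (β : Fin n → ℂ) : Fin n ⊕ Unit → ℂ :=
  Sum.elim (fun i => Complex.exp (-Complex.I * phase x t (conj k)) * β i)
    (fun _ => -Complex.exp (Complex.I * phase x t (conj k)))

/-- `Σ₃ = diag(I_n, -1)`. -/
def sigma3 (n : ℕ) : Matrix (Fin n ⊕ Unit) (Fin n ⊕ Unit) ℂ := fromBlocks 1 0 0 (-1)

/-- The projector `Π_{j,{1 … j-1}}(x, t)` in the dressing of the zero solution by
the data `(k₁, β₁), …, (k_N, β_N)`, in this order. -/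
def laxProj {n N : ℕ} (k : Fin N → ℂ) (β : Fin N → Fin n → ℂ) (x t : ℝ) (j : Fin N) :
    Matrix (Fin n ⊕ Unit) (Fin n ⊕ Unit) ℂ :=
  let L := List.ofFn fun m : Fin N => (k m, seed x t (k m) (β m))
  lineProj ((dress (L.take j) (k j))ᴴ *ᵥ seed x t (k j) (β j))

/-- `Q(x, t) = ∑ⱼ i (k_j - k_j^*) [Σ₃, Π_{j,{1 … j-1}}(x, t)]`. -/
def laxPotential {n N : ℕ} (k : Fin N → ℂ) (β : Fin N → Fin n → ℂ) (x t : ℝ) :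
    Matrix (Fin n ⊕ Unit) (Fin n ⊕ Unit) ℂ :=
  ∑ j, (Complex.I * (k j - conj (k j))) •
    (sigma3 n * laxProj k β x t j - laxProj k β x t j * sigma3 n)

/-- The `N`-soliton solution: the upper right `n × 1` block of `Q`. -/
def nSoliton {n N : ℕ} (k : Fin N → ℂ) (β : Fin N → Fin n → ℂ) (x t : ℝ) : Fin n → ℂ :=
  fun i => laxPotential k β x t (Sum.inl i) (Sum.inr ())

/-- The one-soliton solution with `k = (u + i v) / 2` and norming constant `b`:
polarization `b / |b|`, velocity `-2u`, amplitude `v`, position `log |b| / v` at `t = 0`. -/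
def oneSoliton {n : ℕ} (k : ℂ) (b : Fin n → ℂ) (x t : ℝ) : Fin n → ℂ :=
  let u : ℝ := 2 * k.re
  let v : ℝ := 2 * k.im
  ((v : ℂ) * Complex.exp (-Complex.I * ((u * x + (u ^ 2 - v ^ 2) * t : ℝ) : ℂ))
      / (Real.cosh (v * (x + 2 * u * t - Real.log (euclNorm b) / v)) : ℂ))
    • ((euclNorm b : ℂ)⁻¹ • b)

/-- The nonzero vectors `b_j` describe the asymptotic state of `q` along the filter `l` of times
(`atBot`: before the collision, `atTop`: after it): uniformly in `x`, the field `q` approaches the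
superposition of the one-solitons with parameters `k_j` and norming constants `b_j`. The asymptotic
polarization of soliton `j` is the direction of `b_j`. -/
def IsAsymptoticState {n N : ℕ} (k : Fin N → ℂ) (q : ℝ → ℝ → Fin n → ℂ) (l : Filter ℝ)
    (b : Fin N → Fin n → ℂ) : Prop :=
  (∀ j, b j ≠ 0) ∧
  TendstoUniformly (fun t x => q x t - ∑ j, oneSoliton (k j) (b j) x t) (fun _ => 0) l

/-! ### Yang-Baxter maps -/

/-- The action of `R : X × X → X × X` on the factors `i` (first argument) and `j`
(second argument) of a power of `X`. -/
def pairAct {X ι : Type*} [DecidableEq ι] (R : X × X → X × X) (i j : ι) (p : ι → X) : ι → X :=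
  Function.update (Function.update p i (R (p i, p j)).1) j (R (p i, p j)).2

/-- The parametric Yang-Baxter equation, for parameters that are pairwise in general position. -/
def IsParametricYangBaxterMap {K X : Type*} (gen : K → K → Prop)
    (R : K → K → X × X → X × X) : Prop :=
  ∀ k₁ k₂ k₃, gen k₁ k₂ → gen k₁ k₃ → gen k₂ k₃ →
    (pairAct (R k₁ k₂) 0 1 ∘ pairAct (R k₁ k₃) 0 2 ∘ pairAct (R k₂ k₃) 1 2 :
        (Fin 3 → X) → Fin 3 → X)
      = pairAct (R k₂ k₃) 1 2 ∘ pairAct (R k₁ k₃) 0 2 ∘ pairAct (R k₁ k₂) 0 1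

/-- Reversibility `R₂₁(k₂, k₁) R(k₁, k₂) = Id`, where `R₂₁ = P R P` with `P` the flip. -/
def IsReversible {K X : Type*} (gen : K → K → Prop) (R : K → K → X × X → X × X) : Prop :=
  ∀ k₁ k₂, gen k₁ k₂ → (Prod.swap ∘ R k₂ k₁ ∘ Prod.swap) ∘ R k₁ k₂ = id

/-- The space of polarizations `ℂℙⁿ⁻¹`. -/
abbrev Pol (n : ℕ) : Type := Projectivization ℂ (Fin n → ℂ)

open Classical in
/-- The transformation of `ℂℙⁿ⁻¹` induced by `1 + (c - 1) p p† / (p† p)`, for `c ≠ 0`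
(when this matrix is injective; the other branch is irrelevant). -/
def scalePol {n : ℕ} (c : ℂ) (p : Pol n) : Pol n → Pol n :=
  if h : Function.Injective (toLin' (scaleLine c p.rep)) then
    Projectivization.map (toLin' (scaleLine c p.rep)) h
  else id

/-- The map of a pairwise collision on `ℂℙⁿ⁻¹ × ℂℙⁿ⁻¹`. -/
def collisionMap (n : ℕ) (k₁ k₂ : ℂ) (p : Pol n × Pol n) : Pol n × Pol n :=
  (scalePol ((conj k₁ - k₂) / (conj k₁ - conj k₂)) p.2 p.1,
   scalePol ((k₂ - conj k₁) / (k₂ - k₁)) p.1 p.2)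

/-- The parameters for which the collision map has neither poles nor zeros. It holds for any two
distinct points of the upper half-plane. -/
def GeneralPosition (k₁ k₂ : ℂ) : Prop := k₁ ≠ k₂ ∧ k₁ ≠ conj k₂

lemma scaleLine_mulVec_ne_zero {n : ℕ} {c : ℂ} (hc : c ≠ 0) (w : Fin n → ℂ) {v : Fin n → ℂ}
    (hv : v ≠ 0) : scaleLine c w *ᵥ v ≠ 0 := fun h =>
  hv (mulVec_injective_of_isUnit (isUnit_scaleLine hc w) (by simpa using h))

/-- On representatives `scalePol` is given by the matrix formula. -/
lemma scalePol_mk {n : ℕ} {c : ℂ} (hc : c ≠ 0) {w v : Fin n → ℂ} (hw : w ≠ 0) (hv : v ≠ 0) :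
    scalePol c (Projectivization.mk ℂ w hw) (Projectivization.mk ℂ v hv)
      = Projectivization.mk ℂ (scaleLine c w *ᵥ v) (scaleLine_mulVec_ne_zero hc w hv) := by
  obtain ⟨a, ha⟩ := Projectivization.exists_smul_eq_mk_rep ℂ w hw
  have e : scaleLine c (Projectivization.mk ℂ w hw).rep = scaleLine c w := by
    rw [← ha]; exact scaleLine_smul a.ne_zero c w
  have hi : Function.Injective (toLin' (scaleLine c (Projectivization.mk ℂ w hw).rep)) :=
    mulVec_injective_of_isUnit (isUnit_scaleLine hc _)
  rw [scalePol, dif_pos hi, Projectivization.map_mk]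
  simp [e]

/-! ### Collisions inside an `N`-soliton solution -/

/-- Data of an `N`-soliton solution: `k_j` in the upper half-plane, nonzero norming constants, and
solitons labelled so that `Re k_j` increases (the velocities `-4 Re k_j` are distinct). -/
structure SolitonData (n N : ℕ) where
  k : Fin N → ℂ
  β : Fin N → Fin n → ℂ
  im_pos : ∀ j, 0 < (k j).im
  β_ne_zero : ∀ j, β j ≠ 0
  re_strictMono : StrictMono fun j => (k j).re

namespace SolitonData

variable {n N : ℕ} (S : SolitonData n N)

/-- The `N`-soliton solution attached to the data. -/
def field : ℝ → ℝ → Fin n → ℂ := nSoliton S.k S.β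

/-- An arrangement of the solitons on the line is a permutation `σ`: the soliton `σ m` stands at
place `m` from the left. `rightOf σ j` lists, from left to right, the solitons at the right of
soliton `j`. -/
def rightOf (σ : Equiv.Perm (Fin N)) (j : Fin N) : List (Fin N) :=
  ((List.finRange N).filter fun m => σ.symm j < m).map σ

/-- Norming constant of soliton `j` when the solitons are arranged as `σ`: with `σ = (i₁ … i_N)`
and `j = i_a` it is `∏_{m < a} f_{i_m}(k_j^*) · d_{i_{a+1} … i_N}(k_j)† β_j`. -/
def norming (σ : Equiv.Perm (Fin N)) (j : Fin N) : Fin n → ℂ :=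
  (∏ m with m < σ.symm j, blaschke (S.k (σ m)) (conj (S.k j))) •
    ((dress ((rightOf σ j).map fun m => (S.k m, S.β m)) (S.k j))ᴴ *ᵥ S.β j)

lemma norming_ne_zero (σ : Equiv.Perm (Fin N)) (j : Fin N) : S.norming σ j ≠ 0 := by
  have hinj : Function.Injective S.k := fun a b h =>
    S.re_strictMono.injective (congrArg Complex.re h)
  have hpos : ∀ a b, S.k a ≠ conj (S.k b) := fun a b h => by
    have h1 := S.im_pos a
    have h2 := S.im_pos b
    rw [h, Complex.conj_im] at h1
    linarith
  refine smul_ne_zero (Finset.prod_ne_zero_iff.2 fun m hm => ?_) ?_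
  · have hne : σ m ≠ j := by
      rintro rfl
      simp at hm
    refine div_ne_zero (sub_ne_zero.2 (hpos _ _).symm) (sub_ne_zero.2 fun h => hne ?_)
    exact (hinj ((starRingEnd ℂ).injective h)).symm
  · intro h
    have hu : IsUnit (dress ((rightOf σ j).map fun m => (S.k m, S.β m)) (S.k j)) := by
      refine isUnit_dress _ _ fun s hs => ?_
      obtain ⟨m, hm, rfl⟩ := List.mem_map.1 hs
      have hne : j ≠ m := by
        rintro rfl
        obtain ⟨a, ha, rfl⟩ := List.mem_map.1 hm
        simp at ha
      exact div_ne_zero (sub_ne_zero.2 fun e => hne (hinj e)) (sub_ne_zero.2 (hpos _ _))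
    exact S.β_ne_zero j (mulVec_injective_of_isUnit ((isUnit_conjTranspose _).2 hu) (by simpa using h))

/-- The polarizations of the solitons when they are arranged as `σ`. -/
def pol (σ : Equiv.Perm (Fin N)) (j : Fin N) : Pol n :=
  Projectivization.mk ℂ (S.norming σ j) (S.norming_ne_zero σ j)

/-- The effect on the `N` polarizations of the collision of soliton `c.1`, coming from the left,
with soliton `c.2`. -/
def collide (p : Fin N → Pol n) (c : Fin N × Fin N) : Fin N → Pol n :=
  pairAct (collisionMap n (S.k c.1) (S.k c.2)) c.1 c.2 p

end SolitonData

/-- `CollisionHistory σ L`: the successive pairwise collisions in the list `L` lead from the initial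
arrangement `1, 2, …, N` to the arrangement `σ`. In each collision two neighbours, the left one
being the faster (having the smaller label), exchange their places. -/
inductive CollisionHistory {N : ℕ} : Equiv.Perm (Fin N) → List (Fin N × Fin N) → Prop
  | nil : CollisionHistory 1 []
  | collision {σ : Equiv.Perm (Fin N)} {L : List (Fin N × Fin N)} (a b : Fin N)
      (hL : CollisionHistory σ L) (hab : (b : ℕ) = a + 1) (hlt : σ a < σ b) :
      CollisionHistory (σ * Equiv.swap a b) (L ++ [(σ a, σ b)])

end

end Manakov

namespace Manakov

open Matrix Filter
open scoped ComplexConjugate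

noncomputable section

/-! ### Algebra of the dressing factors -/

section DressingAlgebra

variable {ι : Type*} [Fintype ι]

/-! Everything rests on permutability, `dressFactor_exchange`: dressing by two data gives the same
matrix function in either order. It is used twice, for the norming constants in `ℂⁿ` and for the
seed vectors in `ℂⁿ⁺¹`.

In `ℂⁿ` it yields the collision laws. The polarization of soliton `j` is the line of `d(k_j)† β_j`,
where `d` is dressed from the solitons on the right of `j`; by permutability only the set of these
solitons matters. When neighbours `j, l` collide, let `u, w` be their vectors dressed by everything
on the right of both. Their polarizations pass from `(d_l† u, w)` to `(u, d_j† w)`, and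
`collisionMap_mk` identifies this change with the collision map. For Yang–Baxter, any three lines
are the polarizations of suitable data in the arrangement `(1,2,3)`; both sides of the equation
carry them to those of `(3,2,1)`, which do not remember the path. A collision history lists the
inversions of the arrangement reached, one per collision, so completing a history is bubble sort.

In `ℂⁿ⁺¹` the field is, up to a factor, a corner of the coefficient of `-1/z` of the dressing factor
`D` at infinity, whence its independence of the order. The factor has simple poles at the `k_j^*`,
its residue at `k_j^*` has the form `v_j X_j`, and `D(k_j)† v_j = 0`. These conditions give the
coefficient as `V M⁻¹ V†` with the Cauchy-like matrix `M` of `cauchyGram`, which satisfies `K M - M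
K^* = V† V`. The latter identity makes the derivatives of all moments `V (K^*)^m M⁻¹ V†` polynomials
in moments, and the differential equation becomes matrix algebra.

The asymptotics are a compactness argument. The seed vectors matter only up to scaling, so their
normalized coefficients live in a compact set. Along any ultrafilter of points `(t, x)` with `t`
tending to `±∞` they converge, and since the solitons separate, the limit has at most one vector off
the coordinate blocks. For such a configuration the coefficient is computed exactly
(`dressCoeff_config_apply`), and it produces the norming constants of the arrangement; continuity of
the closed form (`tendsto_dressCoeff`) does the rest. Uniqueness follows by moving along with one
soliton, away from all the others. -/

lemma conj_dotProduct_self (v : ι → ℂ) : conj (star v ⬝ᵥ v) = star v ⬝ᵥ v := by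
  have := star_dotProduct_star v (star v)
  rw [star_star] at this
  rw [← Complex.star_def, this.symm]

lemma star_dotProduct_conj (u w : ι → ℂ) : conj (star u ⬝ᵥ w) = star w ⬝ᵥ u := by
  have := star_dotProduct_star w (star u)
  rw [star_star] at this
  rw [← Complex.star_def, this.symm]

lemma star_dotProduct_self_ne_zero {v : ι → ℂ} (hv : v ≠ 0) : star v ⬝ᵥ v ≠ 0 := by
  open scoped ComplexOrder in simpa using hv

lemma conjTranspose_lineProj (v : ι → ℂ) : (lineProj v)ᴴ = lineProj v := by
  rw [lineProj, conjTranspose_smul, conjTranspose_vecMulVec, star_star, star_inv₀]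
  congr 2
  exact conj_dotProduct_self v

lemma lineProj_mulVec (v w : ι → ℂ) :
    lineProj v *ᵥ w = ((star v ⬝ᵥ v)⁻¹ * (star v ⬝ᵥ w)) • v := by
  rw [lineProj, smul_mulVec, vecMulVec_mulVec]
  ext i; simp; ring

@[simp] lemma lineProj_zero : lineProj (0 : ι → ℂ) = 0 := by
  ext; simp [lineProj, vecMulVec]

variable [DecidableEq ι]

lemma lineProj_smul {a : ℂ} (ha : a ≠ 0) (v : ι → ℂ) : lineProj (a • v) = lineProj v := by
  have h := scaleLine_smul ha 2 v
  simpa [scaleLine, show (2 : ℂ) - 1 = 1 by norm_num] using h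

lemma conjTranspose_scaleLine (c : ℂ) (v : ι → ℂ) :
    (scaleLine c v)ᴴ = scaleLine (conj c) v := by
  simp [scaleLine, conjTranspose_add, conjTranspose_smul, conjTranspose_lineProj]

lemma scaleLine_mulVec (c : ℂ) (v w : ι → ℂ) :
    scaleLine c v *ᵥ w = w + ((c - 1) * ((star v ⬝ᵥ v)⁻¹ * (star v ⬝ᵥ w))) • v := by
  rw [scaleLine, add_mulVec, one_mulVec, smul_mulVec, lineProj_mulVec, smul_smul]

@[simp] lemma scaleLine_one (v : ι → ℂ) : scaleLine 1 v = 1 := by simp [scaleLine]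

@[simp] lemma scaleLine_zero_right (c : ℂ) : scaleLine c (0 : ι → ℂ) = 1 := by simp [scaleLine]

lemma scaleLine_inv_mulVec {c : ℂ} (hc : c ≠ 0) (v w : ι → ℂ) :
    scaleLine c⁻¹ v *ᵥ (scaleLine c v *ᵥ w) = w := by
  rw [mulVec_mulVec, scaleLine_mul, inv_mul_cancel₀ hc, scaleLine_one, one_mulVec]

lemma scaleLine_mulVec_ne {c : ℂ} (hc : c ≠ 0) (v : ι → ℂ) {w : ι → ℂ} (hw : w ≠ 0) :
    scaleLine c v *ᵥ w ≠ 0 := fun h => hw (by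
  rw [← scaleLine_inv_mulVec hc v w, h, mulVec_zero])

/-- A dressed vector has the form `u + γ w`, so the product in either order lies in the span of `1`
and the four dyads of `u` and `w`. The permutability of two factors can then be checked coefficient
by coefficient. -/
lemma scaleLine_mul_scaleLine_add_smul (f g γ : ℂ) (u w : ι → ℂ) :
    scaleLine f w * scaleLine g (u + γ • w)
      = 1 + ((f - 1) * (star w ⬝ᵥ w)⁻¹) • vecMulVec w (star w)
        + ((g - 1) * (star (u + γ • w) ⬝ᵥ (u + γ • w))⁻¹) •
          (vecMulVec u (star u) + conj γ • vecMulVec u (star w)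
            + (γ + (f - 1) * (star w ⬝ᵥ w)⁻¹ * (star w ⬝ᵥ (u + γ • w))) •
                (vecMulVec w (star u) + conj γ • vecMulVec w (star w))) := by
  set P := star (u + γ • w) ⬝ᵥ (u + γ • w)
  have e : vecMulVec (u + γ • w) (star (u + γ • w))
      = vecMulVec u (star u) + conj γ • vecMulVec u (star w)
        + γ • (vecMulVec w (star u) + conj γ • vecMulVec w (star w)) := by
    ext i j; simp [vecMulVec_apply]; ring
  have e2 : vecMulVec w (star w) * vecMulVec (u + γ • w) (star (u + γ • w))
      = (star w ⬝ᵥ (u + γ • w)) • (vecMulVec w (star u) + conj γ • vecMulVec w (star w)) := by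
    rw [vecMulVec_mul_vecMulVec]
    ext i j; simp [vecMulVec_apply]; ring
  simp only [scaleLine, lineProj]
  simp only [mul_add, add_mul, one_mul, mul_one, smul_mul_smul_comm, smul_smul, e2]
  rw [e]
  module

lemma dotProduct_scaleLine_left (c : ℂ) {w : ι → ℂ} (hw : w ≠ 0) (u : ι → ℂ) :
    star w ⬝ᵥ (scaleLine c w *ᵥ u) = c * (star w ⬝ᵥ u) := by
  have := star_dotProduct_self_ne_zero hw
  rw [scaleLine_mulVec, dotProduct_add, dotProduct_smul, smul_eq_mul]
  field_simp; ring

/-- Used with `c` a conjugated value of `blaschke`: the numerator is then symmetric in the two data,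
which is why the denominator is kept apart. -/
lemma dotProduct_scaleLine_self (c : ℂ) {w : ι → ℂ} (hw : w ≠ 0) (u : ι → ℂ) :
    star (scaleLine c w *ᵥ u) ⬝ᵥ (scaleLine c w *ᵥ u)
      = ((star u ⬝ᵥ u) * (star w ⬝ᵥ w) + (c * conj c - 1) * (star u ⬝ᵥ w) * (star w ⬝ᵥ u))
        / (star w ⬝ᵥ w) := by
  have := star_dotProduct_self_ne_zero hw
  have h2 := conj_dotProduct_self w
  rw [← Complex.star_def] at h2
  rw [scaleLine_mulVec, star_add, star_smul, add_dotProduct, dotProduct_add, dotProduct_add,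
    smul_dotProduct, smul_dotProduct, dotProduct_smul, dotProduct_smul]
  simp only [smul_eq_mul, star_mul', star_sub, star_one, star_inv₀, h2]
  simp only [Complex.star_def, star_dotProduct_conj]
  field_simp; ring

/-- The coefficient identities behind the exchange of two dressing factors. -/
lemma exchange_scalar {z kj kl kj' kl' A B s s' E : ℂ} (hzj : z - kj' ≠ 0) (hzl : z - kl' ≠ 0)
    (h1 : kj - kl' ≠ 0) (h2 : kl - kj' ≠ 0) (hA : A ≠ 0) (_hB : B ≠ 0) (hE : E ≠ 0)
    (hEe : E = A * B + ((kj' - kl') / (kj' - kl) * ((kj - kl) / (kj - kl')) - 1) * s * s') :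
    ((z - kj) / (z - kj') - 1) * (E / B)⁻¹ = ((z - kj) / (z - kj') - 1) * A⁻¹
      + ((z - kl) / (z - kl') - 1) * (E / A)⁻¹ *
        ((((kl' - kj') / (kl' - kj) - 1) * (A⁻¹ * s)
          + ((z - kj) / (z - kj') - 1) * A⁻¹ * ((kl' - kj') / (kl' - kj) * s))
        * (((kl - kj) / (kl - kj') - 1) * (A⁻¹ * s'))) := by
  have h1' : kl' - kj ≠ 0 := fun h => h1 (by linear_combination -h)
  have h2' : kj' - kl ≠ 0 := fun h => h2 (by linear_combination -h)
  field_simp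
  rw [hEe]
  field_simp
  ring

lemma exchange_scalar_cross {z kj kl kj' kl' A B s E : ℂ} (hzj : z - kj' ≠ 0) (hzl : z - kl' ≠ 0)
    (h1 : kj - kl' ≠ 0) (hA : A ≠ 0) (hB : B ≠ 0) (hE : E ≠ 0) :
    ((z - kj) / (z - kj') - 1) * (E / B)⁻¹ * (((kj - kl) / (kj - kl') - 1) * (B⁻¹ * s))
      = ((z - kl) / (z - kl') - 1) * (E / A)⁻¹ *
        (((kl' - kj') / (kl' - kj) - 1) * (A⁻¹ * s)
          + ((z - kj) / (z - kj') - 1) * A⁻¹ * ((kl' - kj') / (kl' - kj) * s)) := by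
  have h1' : kl' - kj ≠ 0 := fun h => h1 (by linear_combination -h)
  field_simp
  ring

/-- Two dressing factors may be applied in either order. -/
lemma dressFactor_exchange {kj kl z : ℂ} (h : GeneralPosition kj kl) (hzj : z ≠ conj kj)
    (hzl : z ≠ conj kl) (u w : ι → ℂ) :
    dressFactor kl w z * dressFactor kj ((dressFactor kl w kj)ᴴ *ᵥ u) z
      = dressFactor kj u z * dressFactor kl ((dressFactor kj u kl)ᴴ *ᵥ w) z := by
  by_cases hu : u = 0
  · subst hu; simp [dressFactor]
  by_cases hw : w = 0
  · subst hw; simp [dressFactor]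
  have h0 : kj - kl ≠ 0 := sub_ne_zero.2 h.1
  have h1 : kj - conj kl ≠ 0 := sub_ne_zero.2 h.2
  have h2 : kl - conj kj ≠ 0 := sub_ne_zero.2 fun e => h.2 (by rw [e, Complex.conj_conj])
  have h0' : conj kj - conj kl ≠ 0 := by
    rw [← map_sub]; exact (map_ne_zero _).2 h0
  have h1' : conj kj - kl ≠ 0 := fun e => h2 (by linear_combination -e)
  have h2' : conj kl - kj ≠ 0 := fun e => h1 (by linear_combination -e)
  have hA := star_dotProduct_self_ne_zero hu
  have hB := star_dotProduct_self_ne_zero hw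
  have hzj' := sub_ne_zero.2 hzj
  have hzl' := sub_ne_zero.2 hzl
  have hc : conj (blaschke kl kj) = (conj kj - conj kl) / (conj kj - kl) := by simp [blaschke]
  have hc' : conj (blaschke kj kl) = (conj kl - conj kj) / (conj kl - kj) := by simp [blaschke]
  simp only [dressFactor, conjTranspose_scaleLine]
  have hP := dotProduct_scaleLine_self (conj (blaschke kl kj)) hw u
  have hQ := dotProduct_scaleLine_self (conj (blaschke kj kl)) hu w
  have hp0 : star (scaleLine (conj (blaschke kl kj)) w *ᵥ u) ⬝ᵥ
      (scaleLine (conj (blaschke kl kj)) w *ᵥ u) ≠ 0 := star_dotProduct_self_ne_zero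
    (scaleLine_mulVec_ne (by rw [hc]; exact div_ne_zero h0' h1') w hu)
  have hwp := dotProduct_scaleLine_left (conj (blaschke kl kj)) hw u
  have huq := dotProduct_scaleLine_left (conj (blaschke kj kl)) hu w
  rw [Complex.conj_conj, hc, blaschke] at hP
  rw [Complex.conj_conj, hc', blaschke] at hQ
  rw [hc] at hwp
  rw [hc'] at huq
  rw [hc, hP] at hp0
  have hE := (div_ne_zero_iff.1 hp0).1
  -- Since `|f_j(k_l)| = |f_l(k_j)|`, the squared norms of the two dressed vectors have the same
  -- numerator, named `E` below.
  have hEQ : (star w ⬝ᵥ w) * (star u ⬝ᵥ u) + ((conj kl - conj kj) / (conj kl - kj) *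
      ((kl - kj) / (kl - conj kj)) - 1) * (star w ⬝ᵥ u) * (star u ⬝ᵥ w)
      = (star u ⬝ᵥ u) * (star w ⬝ᵥ w) + ((conj kj - conj kl) / (conj kj - kl) *
      ((kj - kl) / (kj - conj kl)) - 1) * (star u ⬝ᵥ w) * (star w ⬝ᵥ u) := by
    field_simp; ring
  rw [hEQ] at hQ
  obtain ⟨E, hEe⟩ : ∃ E, E = (star u ⬝ᵥ u) * (star w ⬝ᵥ w) + ((conj kj - conj kl) / (conj kj - kl) *
      ((kj - kl) / (kj - conj kl)) - 1) * (star u ⬝ᵥ w) * (star w ⬝ᵥ u) := ⟨_, rfl⟩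
  rw [← hEe] at hP hQ hE
  have i1 := exchange_scalar hzj' hzl' h1 h2 hA hB hE hEe
  have i2 := exchange_scalar hzl' hzj' h2 h1 hB hA hE (by rw [hEe, hEQ])
  have i3 := exchange_scalar_cross (kl := kl) (s := star u ⬝ᵥ w) hzj' hzl' h1 hA hB hE
  have i4 := exchange_scalar_cross (kl := kj) (s := star w ⬝ᵥ u) hzl' hzj' h2 hB hA hE
  rw [hc, hc']
  have hBc := conj_dotProduct_self w
  have hAc := conj_dotProduct_self u
  rw [scaleLine_mulVec] at hP hQ hwp huq ⊢
  rw [scaleLine_mulVec]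
  rw [scaleLine_mul_scaleLine_add_smul, scaleLine_mul_scaleLine_add_smul, hP, hQ, hwp, huq]
  simp only [map_mul, map_sub, map_div₀, map_one, map_inv₀, Complex.conj_conj, hAc, hBc,
    star_dotProduct_conj, blaschke]
  -- The goals are the coefficients of `w w†`, `u u†`, `u w†` and `w u†`; the second and fourth
  -- scalar identities arise from the first and third by exchanging the data.
  match_scalars
  all_goals simp only [mul_one]
  · linear_combination -i2
  · linear_combination i1
  · linear_combination i3
  · linear_combination -i4

lemma GeneralPosition.symm {k₁ k₂ : ℂ} (h : GeneralPosition k₁ k₂) : GeneralPosition k₂ k₁ :=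
  ⟨h.1.symm, fun e => h.2 (by rw [e, Complex.conj_conj])⟩

lemma GeneralPosition.blaschke_ne_zero {k₁ k₂ : ℂ} (h : GeneralPosition k₁ k₂) :
    blaschke k₁ k₂ ≠ 0 :=
  div_ne_zero (sub_ne_zero.2 h.1.symm) (sub_ne_zero.2 h.symm.2)

lemma GeneralPosition.conj_blaschke_ne_zero {k₁ k₂ : ℂ} (h : GeneralPosition k₁ k₂) :
    conj (blaschke k₁ k₂) ≠ 0 :=
  (map_ne_zero _).2 h.blaschke_ne_zero

lemma conjTranspose_dressFactor (k z : ℂ) (v : ι → ℂ) :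
    (dressFactor k v z)ᴴ = scaleLine (conj (blaschke k z)) v := conjTranspose_scaleLine _ _

/-- The line of the second vector after the exchange of two dressing factors, expressed through
the lines before the exchange. -/
lemma scaleLine_exchange_mulVec {kj kl : ℂ} (h : GeneralPosition kj kl) {u w : ι → ℂ}
    (hu : u ≠ 0) (hw : w ≠ 0) :
    ∃ a : ℂ, a • ((dressFactor kj u kl)ᴴ *ᵥ w)
      = scaleLine ((kl - conj kj) / (kl - kj)) ((dressFactor kl w kj)ᴴ *ᵥ u) *ᵥ w := by
  have h0 : kl - kj ≠ 0 := sub_ne_zero.2 h.1.symm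
  have h1 : kj - conj kl ≠ 0 := sub_ne_zero.2 h.2
  have h2 : kl - conj kj ≠ 0 := sub_ne_zero.2 h.symm.2
  have h1' : conj kj - kl ≠ 0 := fun e => h2 (by linear_combination -e)
  have h2' : conj kl - kj ≠ 0 := fun e => h1 (by linear_combination -e)
  have hA := star_dotProduct_self_ne_zero hu
  have hB := star_dotProduct_self_ne_zero hw
  have hc : conj (blaschke kl kj) = (conj kj - conj kl) / (conj kj - kl) := by simp [blaschke]
  have hc' : conj (blaschke kj kl) = (conj kl - conj kj) / (conj kl - kj) := by simp [blaschke]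
  simp only [conjTranspose_dressFactor]
  have hp0 := star_dotProduct_self_ne_zero (scaleLine_mulVec_ne h.symm.conj_blaschke_ne_zero w hu)
  have hP := dotProduct_scaleLine_self (conj (blaschke kl kj)) hw u
  have hpw : star (scaleLine (conj (blaschke kl kj)) w *ᵥ u) ⬝ᵥ w
      = blaschke kl kj * (star u ⬝ᵥ w) := by
    rw [← star_dotProduct_conj, dotProduct_scaleLine_left _ hw, map_mul, Complex.conj_conj,
      star_dotProduct_conj]
  rw [scaleLine_mulVec ((kl - conj kj) / (kl - kj)), hpw, scaleLine_mulVec (conj (blaschke kj kl))]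
  rw [Complex.conj_conj] at hP
  rw [hP] at hp0 ⊢
  have hf : blaschke kl kj = (kj - kl) / (kj - conj kl) := rfl
  rw [hc, hf] at hp0
  rw [hc', hc, hf, scaleLine_mulVec]
  have hE := (div_ne_zero_iff.1 hp0).1
  obtain ⟨E, hEe⟩ : ∃ E, E = (star u ⬝ᵥ u) * (star w ⬝ᵥ w) + ((conj kj - conj kl) / (conj kj - kl) *
      ((kj - kl) / (kj - conj kl)) - 1) * (star u ⬝ᵥ w) * (star w ⬝ᵥ u) := ⟨_, rfl⟩
  rw [← hEe] at hE ⊢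
  -- The scalar is read off from the coefficient of `w` on both sides.
  refine ⟨(star u ⬝ᵥ u) * (star w ⬝ᵥ w) / E, ?_⟩
  match_scalars
  · field_simp
    rw [hEe]
    field_simp
    ring
  · field_simp
    ring

/-- The bridge between collisions and dressing. Before the collision `j` has `l` on its right and is
dressed by it; afterwards `l` is dressed by `j`. The first component of the map undoes the dressing
of `u` by `w`; the second is `scaleLine_exchange_mulVec`. -/
lemma collisionMap_mk {n : ℕ} {kj kl : ℂ} (h : GeneralPosition kj kl) {u w p q : Fin n → ℂ}
    (hu : u ≠ 0) (hw : w ≠ 0) (hp : p ≠ 0) (hq : q ≠ 0)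
    (ep : p = (dressFactor kl w kj)ᴴ *ᵥ u) (eq : q = (dressFactor kj u kl)ᴴ *ᵥ w) :
    collisionMap n kj kl (Projectivization.mk ℂ p hp, Projectivization.mk ℂ w hw)
      = (Projectivization.mk ℂ u hu, Projectivization.mk ℂ q hq) := by
  have h0 : kl - kj ≠ 0 := sub_ne_zero.2 h.1.symm
  have h2 : kl - conj kj ≠ 0 := sub_ne_zero.2 h.symm.2
  have hc : (conj kj - kl) / (conj kj - conj kl) = (conj (blaschke kl kj))⁻¹ := by simp [blaschke]
  subst ep eq
  rw [collisionMap]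
  simp only
  congr 1
  · rw [scalePol_mk (hc ▸ inv_ne_zero h.symm.conj_blaschke_ne_zero)]
    congr 1
    rw [hc, conjTranspose_dressFactor, scaleLine_inv_mulVec h.symm.conj_blaschke_ne_zero]
  · rw [scalePol_mk (div_ne_zero h2 h0), Projectivization.mk_eq_mk_iff']
    exact scaleLine_exchange_mulVec h hu hw

/-! ### The dressing factor of a list -/

/-- One step of the dressing, for an arbitrary matrix function `D`. -/
def dressStep (D : ℂ → Matrix ι ι ℂ) (s : ℂ × (ι → ℂ)) : ℂ → Matrix ι ι ℂ :=
  fun z => D z * dressFactor s.1 ((D s.1)ᴴ *ᵥ s.2) z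

lemma dress_eq_foldl (L : List (ℂ × (ι → ℂ))) : dress L = L.foldl dressStep fun _ => 1 := rfl

@[simp] lemma dress_nil (z : ℂ) : dress ([] : List (ℂ × (ι → ℂ))) z = 1 := rfl

lemma dress_append_singleton (L : List (ℂ × (ι → ℂ))) (s : ℂ × (ι → ℂ)) (z : ℂ) :
    dress (L ++ [s]) z = dress L z * dressFactor s.1 ((dress L s.1)ᴴ *ᵥ s.2) z := by
  simp [dress, List.foldl_append]

/-- The predicate `p` marks the points where the factors are compared. It has to contain the
parameters of the list, because later steps evaluate the factor there. -/
lemma foldl_dressStep_congr {p : ℂ → Prop} (L : List (ℂ × (ι → ℂ))) :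
    ∀ {D D' : ℂ → Matrix ι ι ℂ}, (∀ s ∈ L, p s.1) → (∀ z, p z → D z = D' z) →
      ∀ z, p z → L.foldl dressStep D z = L.foldl dressStep D' z := by
  induction L with
  | nil => exact fun _ h => h
  | cons s L ih =>
    intro D D' hL h
    refine ih (fun t ht => hL t (by simp [ht])) fun z hz => ?_
    simp only [dressStep, h z hz, h s.1 (hL s (by simp))]

lemma foldl_dressStep_perm {p : ℂ → Prop} {L L' : List (ℂ × (ι → ℂ))} (hLL : L.Perm L') :
    ∀ D : ℂ → Matrix ι ι ℂ, (∀ s ∈ L, p s.1) → (∀ s ∈ L, ∀ z, p z → z ≠ conj s.1) →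
      L.Pairwise (fun s t => GeneralPosition s.1 t.1) →
      ∀ z, p z → L.foldl dressStep D z = L'.foldl dressStep D z := by
  induction hLL with
  | nil => exact fun _ _ _ _ _ _ => rfl
  | cons s _ ih =>
    intro D hp hs hg
    exact ih _ (fun t ht => hp t (by simp [ht])) (fun t ht => hs t (by simp [ht]))
      (List.pairwise_cons.1 hg).2
  | swap s t L =>
    intro D hp hs hg
    refine foldl_dressStep_congr L (fun r hr => hp r (by simp [hr])) fun z hz => ?_
    have hst := (List.pairwise_cons.1 hg).1 s (by simp)
    -- The prefix `D` enters only by replacing each vector `v` by `D(k)† v`, so the two-factor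
    -- exchange applies to the vectors so transformed.
    simp only [dressStep, conjTranspose_mul, ← mulVec_mulVec, mul_assoc]
    rw [dressFactor_exchange hst.symm (hs s (by simp) z hz) (hs t (by simp) z hz)]
  | trans h₁ h₂ ih₁ ih₂ =>
    intro D hp hs hg z hz
    rw [ih₁ D hp hs hg z hz]
    exact ih₂ D (fun t ht => hp t (h₁.mem_iff.2 ht)) (fun t ht => hs t (h₁.mem_iff.2 ht))
      (h₁.pairwise hg fun h => h.symm) z hz

/-- The dressing factor does not depend on the order of the data, away from its poles. -/
lemma dress_perm {p : ℂ → Prop} {L L' : List (ℂ × (ι → ℂ))} (h : L.Perm L')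
    (hp : ∀ s ∈ L, p s.1) (hs : ∀ s ∈ L, ∀ z, p z → z ≠ conj s.1)
    (hg : L.Pairwise (fun s t => GeneralPosition s.1 t.1)) {z : ℂ} (hz : p z) :
    dress L z = dress L' z :=
  foldl_dressStep_perm h _ hp hs hg z hz

end DressingAlgebra

/-! ### The collision map is a reversible Yang-Baxter map -/

section YangBaxter

variable {ι : Type*} [Fintype ι] [DecidableEq ι]

/-- At the parameter of a third soliton: its polarization vector with two others on its right
depends only on the set of these two. -/
lemma dressFactor_exchange_mulVec {ka kb z : ℂ} (h : GeneralPosition ka kb) (hza : z ≠ conj ka)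
    (hzb : z ≠ conj kb) (va vb v : ι → ℂ) :
    (dressFactor kb ((dressFactor ka va kb)ᴴ *ᵥ vb) z)ᴴ *ᵥ ((dressFactor ka va z)ᴴ *ᵥ v)
      = (dressFactor ka ((dressFactor kb vb ka)ᴴ *ᵥ va) z)ᴴ *ᵥ ((dressFactor kb vb z)ᴴ *ᵥ v) := by
  rw [mulVec_mulVec, mulVec_mulVec, ← conjTranspose_mul, ← conjTranspose_mul,
    dressFactor_exchange h hza hzb]

lemma dressFactor_mulVec_ne_zero {k z : ℂ} (h : GeneralPosition k z) (v : ι → ℂ) {w : ι → ℂ}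
    (hw : w ≠ 0) : (dressFactor k v z)ᴴ *ᵥ w ≠ 0 := by
  rw [conjTranspose_dressFactor]
  exact scaleLine_mulVec_ne h.conj_blaschke_ne_zero v hw

/-- Recovers an undressed vector from a prescribed polarization, so that arbitrary lines can be
treated as polarizations of dressed data. -/
lemma exists_dressFactor_mulVec_eq {k z : ℂ} (h : GeneralPosition k z) (v : ι → ℂ) {w : ι → ℂ}
    (hw : w ≠ 0) : ∃ u, u ≠ 0 ∧ (dressFactor k v z)ᴴ *ᵥ u = w := by
  have hc := inv_ne_zero h.conj_blaschke_ne_zero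
  refine ⟨scaleLine (conj (blaschke k z))⁻¹ v *ᵥ w, scaleLine_mulVec_ne hc v hw, ?_⟩
  have := scaleLine_inv_mulVec hc v w
  rwa [inv_inv, ← conjTranspose_dressFactor] at this

variable {X : Type*} (R : X × X → X × X) (a b c : X)

lemma pairAct_zero_one : pairAct R 0 1 ![a, b, c] = ![(R (a, b)).1, (R (a, b)).2, c] := by
  ext i; fin_cases i <;> simp [pairAct]

lemma pairAct_zero_two : pairAct R 0 2 ![a, b, c] = ![(R (a, c)).1, b, (R (a, c)).2] := by
  ext i; fin_cases i <;> simp [pairAct, Function.update]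

lemma pairAct_one_two : pairAct R 1 2 ![a, b, c] = ![a, (R (b, c)).1, (R (b, c)).2] := by
  ext i; fin_cases i <;> simp [pairAct, Function.update]

theorem isParametricYangBaxterMap_collisionMap (n : ℕ) :
    IsParametricYangBaxterMap GeneralPosition (collisionMap n) := by
  intro k₁ k₂ k₃ h12 h13 h23
  funext p
  obtain ⟨p₁, p₂, p₃, rfl⟩ : ∃ p₁ p₂ p₃, p = ![p₁, p₂, p₃] :=
    ⟨p 0, p 1, p 2, by ext i; fin_cases i <;> rfl⟩
  induction p₁ using Projectivization.ind with | h w₁ hw₁ => ?_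
  induction p₂ using Projectivization.ind with | h w₂ hw₂ => ?_
  induction p₃ using Projectivization.ind with | h b₃ hb₃ => ?_
  -- The given lines become the polarizations of the arrangement `(1,2,3)` with undressed vectors
  -- `b₁, b₂, b₃`, solved for from right to left. Each of the six maps is then a collision; `x1`,
  -- `x2`, `x3` reconcile vectors dressed by the same two data in different orders.
  obtain ⟨b₂, hb₂, rfl⟩ := exists_dressFactor_mulVec_eq h23.symm b₃ hw₂
  obtain ⟨v, hv, e⟩ := exists_dressFactor_mulVec_eq h13.symm ((dressFactor k₂ b₂ k₃)ᴴ *ᵥ b₃) hw₁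
  obtain ⟨b₁, hb₁, rfl⟩ := exists_dressFactor_mulVec_eq h12.symm b₂ hv
  have x1 := dressFactor_exchange_mulVec h23 h12.2 h13.2 b₂ b₃ b₁
  have x2 := dressFactor_exchange_mulVec h13 h12.symm.2 h23.2 b₁ b₃ b₂
  have x3 := dressFactor_exchange_mulVec h12 h13.symm.2 h23.symm.2 b₁ b₂ b₃
  have n31 := dressFactor_mulVec_ne_zero h13.symm b₃ hb₁
  have n12 := dressFactor_mulVec_ne_zero h12 b₁ hb₂
  have n13 := dressFactor_mulVec_ne_zero h13 b₁ hb₃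
  have n23 := dressFactor_mulVec_ne_zero h23 b₂ hb₃
  have n213 := dressFactor_mulVec_ne_zero h13 ((dressFactor k₂ b₂ k₁)ᴴ *ᵥ b₁) n23
  have n312 := dressFactor_mulVec_ne_zero h12 ((dressFactor k₃ b₃ k₁)ᴴ *ᵥ b₁) hw₂
  simp only [Function.comp_apply]
  rw [pairAct_one_two, collisionMap_mk h23 hb₂ hb₃ _ n23 rfl rfl, pairAct_zero_two,
    collisionMap_mk h13 hv n23 _ n213 e.symm rfl, pairAct_zero_one,
    collisionMap_mk h12 hb₁ hb₂ _ n12 rfl rfl, pairAct_zero_one,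
    collisionMap_mk h12 n31 hw₂ _ n312 (e.symm.trans x1) rfl, pairAct_zero_two,
    collisionMap_mk h13 hb₁ hb₃ _ n13 rfl rfl, pairAct_one_two,
    collisionMap_mk h23 n12 n13 _ n213 x2.symm x3.symm]

theorem isReversible_collisionMap (n : ℕ) :
    IsReversible GeneralPosition (collisionMap n) := by
  intro k₁ k₂ h
  funext ⟨p₁, p₂⟩
  induction p₁ using Projectivization.ind with | h w₁ hw₁ => ?_
  induction p₂ using Projectivization.ind with | h b₂ hb₂ => ?_
  obtain ⟨b₁, hb₁, rfl⟩ := exists_dressFactor_mulVec_eq h.symm b₂ hw₁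
  have n12 := dressFactor_mulVec_ne_zero h b₁ hb₂
  simp only [Function.comp_apply]
  rw [collisionMap_mk h hb₁ hb₂ _ n12 rfl rfl]
  simp only [Prod.swap]
  rw [collisionMap_mk h.symm hb₂ hb₁ _ hw₁ rfl rfl]
  rfl

end YangBaxter

/-! ### Collisions inside an `N`-soliton solution -/

namespace SolitonData

variable {n N : ℕ} (S : SolitonData n N)

lemma k_injective : Function.Injective S.k := fun _ _ h =>
  S.re_strictMono.injective (congrArg Complex.re h)

lemma k_ne_conj (i j : Fin N) : S.k i ≠ conj (S.k j) := fun h => by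
  have h1 := S.im_pos i
  have h2 := S.im_pos j
  rw [h, Complex.conj_im] at h1
  linarith

lemma generalPosition {i j : Fin N} (h : i ≠ j) : GeneralPosition (S.k i) (S.k j) :=
  ⟨S.k_injective.ne h, S.k_ne_conj i j⟩

/-- The dressing factor of the norming constants with indices in `l`. -/
def dressOn (l : List (Fin N)) : ℂ → Matrix (Fin n) (Fin n) ℂ :=
  dress (l.map fun m => (S.k m, S.β m))

/-- The polarization vector of soliton `j` when the solitons in `l` stand on its right. -/
def polVec (l : List (Fin N)) (j : Fin N) : Fin n → ℂ := (S.dressOn l (S.k j))ᴴ *ᵥ S.β j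

lemma dressOn_perm {l l' : List (Fin N)} (h : l.Perm l') (hl : l.Nodup) {z : ℂ} (hz : 0 < z.im) :
    S.dressOn l z = S.dressOn l' z := by
  -- The upper half-plane contains all parameters and no pole `k_m^*`.
  refine dress_perm (p := fun z => 0 < z.im) (h.map _) ?_ ?_ ?_ hz
  · simp only [List.mem_map]
    rintro _ ⟨m, -, rfl⟩
    exact S.im_pos m
  · simp only [List.mem_map]
    rintro _ ⟨m, -, rfl⟩ z hz rfl
    have := S.im_pos m
    rw [Complex.conj_im] at hz
    simp only at hz
    linarith
  · rw [List.pairwise_map]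
    exact hl.imp fun h => S.generalPosition h

lemma polVec_perm {l l' : List (Fin N)} (h : l.Perm l') (hl : l.Nodup) (j : Fin N) :
    S.polVec l j = S.polVec l' j := by
  rw [polVec, polVec, S.dressOn_perm h hl (S.im_pos j)]

lemma polVec_append_singleton (l : List (Fin N)) (m j : Fin N) :
    S.polVec (l ++ [m]) j = (dressFactor (S.k m) (S.polVec l m) (S.k j))ᴴ *ᵥ S.polVec l j := by
  simp only [polVec, dressOn, List.map_append, List.map_cons, List.map_nil,
    dress_append_singleton, conjTranspose_mul, mulVec_mulVec]

lemma polVec_ne_zero {l : List (Fin N)} {j : Fin N} (hj : j ∉ l) : S.polVec l j ≠ 0 := by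
  intro h
  have hu : IsUnit (S.dressOn l (S.k j)) := by
    refine isUnit_dress _ _ fun s hs => ?_
    obtain ⟨m, hm, rfl⟩ := List.mem_map.1 hs
    exact (S.generalPosition (ne_of_mem_of_not_mem hm hj)).blaschke_ne_zero
  exact S.β_ne_zero j (mulVec_injective_of_isUnit ((isUnit_conjTranspose _).2 hu)
    (by simpa [polVec] using h))

lemma mem_rightOf (σ : Equiv.Perm (Fin N)) (j m : Fin N) :
    m ∈ rightOf σ j ↔ σ.symm j < σ.symm m := by
  simp only [rightOf, List.mem_map, List.mem_filter, List.mem_finRange, true_and,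
    decide_eq_true_eq]
  constructor
  · rintro ⟨a, ha, rfl⟩
    simpa using ha
  · exact fun h => ⟨_, h, by simp⟩

lemma nodup_rightOf (σ : Equiv.Perm (Fin N)) (j : Fin N) : (rightOf σ j).Nodup :=
  ((List.nodup_finRange N).filter _).map σ.injective

lemma norming_eq (σ : Equiv.Perm (Fin N)) (j : Fin N) :
    S.norming σ j = (∏ m with m < σ.symm j, blaschke (S.k (σ m)) (conj (S.k j))) •
      S.polVec (rightOf σ j) j := rfl

/-- The scalar Blaschke product in the norming constant disappears in projective space, leaving only
the set of solitons on the right of `j`. -/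
lemma pol_eq (σ : Equiv.Perm (Fin N)) {l : List (Fin N)} {j : Fin N}
    (hl : (rightOf σ j).Perm l) (h : S.polVec l j ≠ 0) :
    S.pol σ j = Projectivization.mk ℂ (S.polVec l j) h := by
  rw [pol, Projectivization.mk_eq_mk_iff']
  exact ⟨_, by rw [S.norming_eq, ← S.polVec_perm hl (nodup_rightOf σ j)]⟩

/-- No place lies between two adjacent ones, so their exchange reverses the order of that pair
alone. -/
lemma swap_lt_swap_iff {a b x y : Fin N} (hab : (b : ℕ) = a + 1) (h : ¬(x = a ∧ y = b))
    (h' : ¬(x = b ∧ y = a)) : Equiv.swap a b x < Equiv.swap a b y ↔ x < y := by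
  simp only [Equiv.swap_apply_def]
  split_ifs <;> simp only [Fin.lt_def, Fin.ext_iff] at * <;> omega

/-- A pairwise collision acts on the polarizations through the collision map. -/
theorem pol_mul_swap (σ : Equiv.Perm (Fin N)) (a b : Fin N) (hab : (b : ℕ) = a + 1) :
    S.pol (σ * Equiv.swap a b) = S.collide (S.pol σ) (σ a, σ b) := by
  have hne : a ≠ b := by rintro rfl; omega
  have hlt : a < b := by rw [Fin.lt_def]; omega
  have hσ : σ a ≠ σ b := σ.injective.ne hne
  have hs : ∀ j, (σ * Equiv.swap a b).symm j = Equiv.swap a b (σ.symm j) := fun j => rfl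
  have hperm : ∀ {l l' : List (Fin N)}, l.Nodup → l'.Nodup → (∀ m, m ∈ l ↔ m ∈ l') → l.Perm l' :=
    fun h h' hm => (List.perm_ext_iff_of_nodup h h').2 hm
  have hnb : σ b ∉ rightOf σ (σ b) := by simp [mem_rightOf]
  have hna : σ a ∉ rightOf σ (σ b) := by simp [mem_rightOf, hlt.le]
  -- the solitons on the right of the two colliding ones
  set l := rightOf σ (σ b)
  have hl : l.Nodup := nodup_rightOf σ _
  have happ : ∀ {m}, m ∉ l → (l ++ [m]).Nodup := fun h =>
    List.nodup_append.2 ⟨hl, by simp, by rintro x hx y hy rfl; simp at hy; exact h (hy ▸ hx)⟩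
  have ha : (rightOf σ (σ a)).Perm (l ++ [σ b]) := by
    refine hperm (nodup_rightOf _ _) (happ hnb) fun m => ?_
    simp only [l, mem_rightOf, List.mem_append, List.mem_singleton, Equiv.symm_apply_apply,
      ← Equiv.symm_apply_eq, Fin.lt_def, Fin.ext_iff]
    omega
  have hb' : (rightOf (σ * Equiv.swap a b) (σ b)).Perm (l ++ [σ a]) := by
    refine hperm (nodup_rightOf _ _) (happ hna) fun m => ?_
    simp only [l, mem_rightOf, hs, List.mem_append, List.mem_singleton, Equiv.symm_apply_apply,
      ← Equiv.symm_apply_eq, Equiv.swap_apply_right]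
    simp only [Equiv.swap_apply_def]
    split_ifs <;> simp only [Fin.lt_def, Fin.ext_iff] at * <;> omega
  have ha' : (rightOf (σ * Equiv.swap a b) (σ a)).Perm l := by
    refine hperm (nodup_rightOf _ _) hl fun m => ?_
    simp only [l, mem_rightOf, hs, Equiv.symm_apply_apply, Equiv.swap_apply_left]
    simp only [Equiv.swap_apply_def]
    split_ifs <;> simp only [Fin.lt_def, Fin.ext_iff] at * <;> omega
  have na := S.polVec_ne_zero hna
  have nb := S.polVec_ne_zero hnb
  have na' : S.polVec (l ++ [σ b]) (σ a) ≠ 0 := S.polVec_ne_zero (by simp [hna, hσ])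
  have nb' : S.polVec (l ++ [σ a]) (σ b) ≠ 0 := S.polVec_ne_zero (by simp [hnb, hσ.symm])
  -- With `l` on the right of both, soliton `σ a` loses `σ b` from its right-hand side and `σ b`
  -- gains `σ a`: exactly the situation of `collisionMap_mk` for the vectors dressed by `l`.
  have hc := collisionMap_mk (S.generalPosition hσ) na nb na' nb'
    (S.polVec_append_singleton l _ _) (S.polVec_append_singleton l _ _)
  rw [← S.pol_eq σ ha, ← S.pol_eq σ (List.Perm.refl _), ← S.pol_eq _ ha', ← S.pol_eq _ hb'] at hc
  funext j
  simp only [collide, pairAct, hc]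
  by_cases hjb : j = σ b
  · subst hjb; simp
  by_cases hja : j = σ a
  · subst hja; simp [Function.update_of_ne hσ]
  rw [Function.update_of_ne hjb, Function.update_of_ne hja]
  have hj : (rightOf (σ * Equiv.swap a b) j).Perm (rightOf σ j) := by
    refine hperm (nodup_rightOf _ _) (nodup_rightOf _ _) fun m => ?_
    rw [mem_rightOf, mem_rightOf, hs, hs]
    refine swap_lt_swap_iff hab ?_ ?_
    · rintro ⟨h, -⟩; exact hja (by rw [← h, Equiv.apply_symm_apply])
    · rintro ⟨h, -⟩; exact hjb (by rw [← h, Equiv.apply_symm_apply])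
  have nj : S.polVec (rightOf σ j) j ≠ 0 := S.polVec_ne_zero (by simp [mem_rightOf])
  rw [S.pol_eq _ hj nj, S.pol_eq σ (List.Perm.refl _) nj]

end SolitonData

/-! ### Collision histories -/

namespace CollisionHistory

variable {N : ℕ} {σ : Equiv.Perm (Fin N)} {L : List (Fin N × Fin N)}

/-- The history is the inversion set of the arrangement: a collision of neighbours in increasing
order creates one inversion and changes no other pair. -/
lemma mem_iff (h : CollisionHistory σ L) (j l : Fin N) :
    (j, l) ∈ L ↔ j < l ∧ σ.symm l < σ.symm j := by
  induction h generalizing j l with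
  | nil => exact ⟨fun h => absurd h (by simp), fun h => absurd (h.1.trans h.2) (lt_irrefl _)⟩
  | @collision σ L a b hL hab hlt ih =>
    have hs : ∀ j, (σ * Equiv.swap a b).symm j = Equiv.swap a b (σ.symm j) := fun j => rfl
    rw [List.mem_append, List.mem_singleton, Prod.mk.injEq, ih, hs, hs]
    by_cases h1 : j = σ a ∧ l = σ b
    · obtain ⟨rfl, rfl⟩ := h1
      have : a < b := Fin.lt_def.2 (by omega)
      simp [hlt, this]
    by_cases h2 : j = σ b ∧ l = σ a
    · obtain ⟨rfl, rfl⟩ := h2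
      simp [hlt.ne, hlt.ne', hlt.not_gt]
    rw [SolitonData.swap_lt_swap_iff hab]
    · tauto
    · rw [Equiv.symm_apply_eq, Equiv.symm_apply_eq]; tauto
    · rw [Equiv.symm_apply_eq, Equiv.symm_apply_eq]; tauto

/-- A pair that has collided is inverted, whereas a new collision needs a pair still in increasing
order. -/
lemma nodup (h : CollisionHistory σ L) : L.Nodup := by
  induction h with
  | nil => exact List.nodup_nil
  | @collision σ L a b hL hab hlt ih =>
    refine List.nodup_append.2 ⟨ih, by simp, ?_⟩
    rintro x hx y hy rfl
    rw [List.mem_singleton] at hy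
    rw [hy, mem_iff hL] at hx
    have := hx.2
    rw [Equiv.symm_apply_apply, Equiv.symm_apply_apply, Fin.lt_def] at this
    omega

lemma card_lt_pairs (N : ℕ) :
    (Finset.univ.filter fun c : Fin N × Fin N => c.1 < c.2).card = N.choose 2 := by
  rw [Finset.card_filter, Fintype.sum_prod_type_right]
  simp only [← Finset.card_filter]
  rw [Nat.choose_two_right, ← Finset.sum_range_id, ← Fin.sum_univ_eq_sum_range]
  refine Finset.sum_congr rfl fun l _ => ?_
  rw [show (Finset.univ.filter fun j : Fin N => j < l) = Finset.Iio l by ext; simp, Fin.card_Iio]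

lemma length_le (h : CollisionHistory σ L) : L.length ≤ N.choose 2 := by
  rw [← List.toFinset_card_of_nodup h.nodup, ← card_lt_pairs]
  refine Finset.card_le_card fun c hc => ?_
  rw [List.mem_toFinset] at hc
  simpa using ((h.mem_iff c.1 c.2).1 hc).1

lemma mem_iff_of_complete (h : CollisionHistory Fin.revPerm L) (j l : Fin N) :
    (j, l) ∈ L ↔ j < l := by
  rw [h.mem_iff]
  simp

lemma length_of_complete (h : CollisionHistory Fin.revPerm L) : L.length = N.choose 2 := by
  rw [← List.toFinset_card_of_nodup h.nodup, ← card_lt_pairs]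
  congr 1
  ext c
  rw [List.mem_toFinset, h.mem_iff_of_complete c.1 c.2]
  simp

lemma eq_revPerm_of_forall (h : ∀ a b : Fin N, (b : ℕ) = a + 1 → σ b < σ a) :
    σ = Fin.revPerm := by
  obtain _ | N := N
  · exact Subsingleton.elim _ _
  have ha : StrictAnti σ := Fin.strictAnti_iff_succ_lt.2 fun i => h _ _ (by simp)
  have hm : StrictMono (σ ∘ Fin.rev) := ha.comp Fin.rev_strictAnti
  have := (hm.range_inj strictMono_id).1 (by
    rw [Set.range_id, Function.Surjective.range_eq (σ.surjective.comp Fin.rev_surjective)])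
  ext i
  have := congrFun this (Fin.rev i)
  simp only [Function.comp_apply, Fin.rev_rev, id] at this
  rw [this, Fin.revPerm_apply]

/-- Every collision history can be continued to a complete one. -/
theorem exists_complete (h : CollisionHistory σ L) :
    ∃ L', CollisionHistory Fin.revPerm (L ++ L') := by
  generalize hd : N.choose 2 - L.length = d
  -- Induction on the number of collisions still missing. It drops strictly under truncated
  -- subtraction because the prolonged history also obeys `length_le`.
  induction d using Nat.strong_induction_on generalizing σ L with
  | _ d ih =>
    by_cases hσ : ∀ a b : Fin N, (b : ℕ) = a + 1 → σ b < σ a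
    · obtain rfl := eq_revPerm_of_forall hσ
      exact ⟨[], by simpa using h⟩
    · push Not at hσ
      obtain ⟨a, b, hab, hle⟩ := hσ
      have hne : a ≠ b := by rintro rfl; omega
      have h' := h.collision a b hab (hle.lt_of_ne (σ.injective.ne hne))
      have hlen := h'.length_le
      rw [List.length_append, List.length_singleton] at hlen
      obtain ⟨L', hL'⟩ := ih _ (by rw [List.length_append, List.length_singleton]; omega) h' rfl
      exact ⟨_, by rwa [List.append_assoc] at hL'⟩

lemma foldl_collide {n : ℕ} (S : SolitonData n N) (h : CollisionHistory σ L) :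
    L.foldl S.collide (S.pol 1) = S.pol σ := by
  induction h with
  | nil => rfl
  | collision a b hL hab hlt ih =>
    rw [List.foldl_append, ih, List.foldl_cons, List.foldl_nil, S.pol_mul_swap _ a b hab]

end CollisionHistory

/-! ### The residue at infinity of the dressing factor -/

section DressCoeff

open Topology

variable {ι : Type*} [Fintype ι] [DecidableEq ι]

/-- The increment of `dressCoeff` when the pair `s` is dressed onto the list `L`. -/
def dressTerm (L : List (ℂ × (ι → ℂ))) (s : ℂ × (ι → ℂ)) : Matrix ι ι ℂ :=
  (s.1 - conj s.1) • lineProj ((dress L s.1)ᴴ *ᵥ s.2)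

/-- The sum of the `(k_j - k_j^*) Π_j` along the reversal of a list. -/
def dressCoeffAux : List (ℂ × (ι → ℂ)) → Matrix ι ι ℂ
  | [] => 0
  | s :: L => dressCoeffAux L + dressTerm L.reverse s

/-- The sum of the `(k_j - k_j^*) Π_j` along a list: the coefficient of `-1/z` in the expansion of
the dressing factor at infinity. -/
def dressCoeff (L : List (ℂ × (ι → ℂ))) : Matrix ι ι ℂ := dressCoeffAux L.reverse

@[simp] lemma dressCoeff_nil : dressCoeff ([] : List (ℂ × (ι → ℂ))) = 0 := rfl

lemma dressCoeff_append_singleton (L : List (ℂ × (ι → ℂ))) (s : ℂ × (ι → ℂ)) :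
    dressCoeff (L ++ [s]) = dressCoeff L + dressTerm L s := by
  simp [dressCoeff, dressCoeffAux]

lemma take_succ_ofFn {α : Type*} {N : ℕ} (F : Fin N → α) {m : ℕ} (hm : m < N) :
    (List.ofFn F).take (m + 1) = (List.ofFn F).take m ++ [F ⟨m, hm⟩] := by
  rw [List.take_add_one, List.getElem?_ofFn, dif_pos hm]
  rfl

lemma dressCoeff_ofFn {N : ℕ} (F : Fin N → ℂ × (ι → ℂ)) :
    dressCoeff (List.ofFn F) = ∑ j : Fin N, dressTerm ((List.ofFn F).take j) (F j) := by
  have h : ∀ m ≤ N, dressCoeff ((List.ofFn F).take m) = ∑ i ∈ Finset.range m,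
      if h : i < N then dressTerm ((List.ofFn F).take i) (F ⟨i, h⟩) else 0 := by
    intro m hm
    induction m with
    | zero => simp
    | succ m ih =>
      rw [take_succ_ofFn F hm, dressCoeff_append_singleton, ih (by omega), Finset.sum_range_succ,
        dif_pos (by omega : m < N)]
  have := h N le_rfl
  rw [Finset.sum_range, List.take_of_length_le (by simp)] at this
  simpa using this

lemma tendsto_inv_sub_cobounded (c : ℂ) :
    Tendsto (fun z : ℂ => (z - c)⁻¹) (Bornology.cobounded ℂ) (𝓝 0) :=
  tendsto_inv₀_cobounded.comp (tendsto_sub_const_cobounded c)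

lemma blaschke_sub_one {k z : ℂ} (h : z ≠ conj k) :
    blaschke k z - 1 = -(k - conj k) * (z - conj k)⁻¹ := by
  have := sub_ne_zero.2 h
  rw [blaschke]; field_simp; ring

lemma tendsto_blaschke_sub_one (k : ℂ) :
    Tendsto (fun z => blaschke k z - 1) (Bornology.cobounded ℂ) (𝓝 0) := by
  have := (tendsto_inv_sub_cobounded (conj k)).const_mul (-(k - conj k))
  rw [mul_zero] at this
  refine this.congr' ?_
  filter_upwards [Bornology.eventually_ne_cobounded (conj k)] with z hz
  rw [blaschke_sub_one hz]

lemma tendsto_mul_blaschke_sub_one (k : ℂ) :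
    Tendsto (fun z => z * (blaschke k z - 1)) (Bornology.cobounded ℂ) (𝓝 (-(k - conj k))) := by
  have := ((tendsto_inv_sub_cobounded (conj k)).const_mul (conj k)).const_add 1
    |>.const_mul (-(k - conj k))
  rw [mul_zero, add_zero, mul_one] at this
  refine this.congr' ?_
  filter_upwards [Bornology.eventually_ne_cobounded (conj k)] with z hz
  rw [blaschke_sub_one hz]
  have := sub_ne_zero.2 hz
  field_simp; ring

lemma tendsto_dress (L : List (ℂ × (ι → ℂ))) :
    Tendsto (dress L) (Bornology.cobounded ℂ) (𝓝 1) := by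
  induction L using List.reverseRecOn with
  | nil => exact tendsto_const_nhds
  | append_singleton L s ih =>
    have h2 := ((tendsto_blaschke_sub_one s.1).smul_const
      (lineProj ((dress L s.1)ᴴ *ᵥ s.2))).const_add 1
    have := ih.mul h2
    rw [zero_smul, add_zero, one_mul] at this
    exact this.congr fun z => (dress_append_singleton L s z).symm

/-- At infinity `f(z) - 1` behaves like `-(k - k^*)/z`, and products of such corrections are of
higher order. Hence the sum of projectors, defined through an ordering, is determined by the
function `dress L` alone. -/
lemma tendsto_smul_one_sub_dress (L : List (ℂ × (ι → ℂ))) :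
    Tendsto (fun z : ℂ => z • (1 - dress L z)) (Bornology.cobounded ℂ) (𝓝 (dressCoeff L)) := by
  induction L using List.reverseRecOn with
  | nil => simp
  | append_singleton L s ih =>
    have h2 := (tendsto_mul_blaschke_sub_one s.1).smul_const (lineProj ((dress L s.1)ᴴ *ᵥ s.2))
    have := ih.sub ((tendsto_dress L).mul h2)
    rw [one_mul, neg_smul, sub_neg_eq_add] at this
    rw [dressCoeff_append_singleton]
    refine this.congr fun z => ?_
    rw [dress_append_singleton, dressFactor, scaleLine, mul_add, mul_one, mul_smul_comm,
      mul_smul_comm, smul_sub, smul_sub, smul_add, smul_smul]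
    abel

lemma dress_perm_of_im_pos {L L' : List (ℂ × (ι → ℂ))} (h : L.Perm L')
    (hp : ∀ s ∈ L, 0 < s.1.im) (hd : L.Pairwise fun s t => s.1 ≠ t.1) {z : ℂ}
    (hz : ∀ s ∈ L, z ≠ conj s.1) : dress L z = dress L' z := by
  have hne : ∀ s ∈ L, ∀ t ∈ L, s.1 ≠ conj t.1 := fun s hs t ht e => by
    have h1 := hp s hs
    have h2 := hp t ht
    rw [e, Complex.conj_im] at h1
    linarith
  exact dress_perm (p := fun z => ∀ s ∈ L, z ≠ conj s.1) h hne (fun s hs z hz => hz s hs)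
    (hd.imp_of_mem fun hs ht h => ⟨h, hne _ hs _ ht⟩) hz

lemma dressCoeff_perm {L L' : List (ℂ × (ι → ℂ))} (h : L.Perm L')
    (hp : ∀ s ∈ L, 0 < s.1.im) (hd : L.Pairwise fun s t => s.1 ≠ t.1) :
    dressCoeff L = dressCoeff L' := by
  refine tendsto_nhds_unique ((tendsto_smul_one_sub_dress L).congr' ?_)
    (tendsto_smul_one_sub_dress L')
  have : ∀ᶠ z in Bornology.cobounded ℂ, ∀ s ∈ L, z ≠ conj s.1 :=
    (eventually_all_finite L.finite_toSet).2 fun s _ => Bornology.eventually_ne_cobounded _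
  filter_upwards [this] with z hz
  rw [dress_perm_of_im_pos h hp hd hz]

end DressCoeff

/-! ### The field in terms of the residue -/

/-- The list of the data of an `N`-soliton solution at `(x, t)`. -/
def seedList {n N : ℕ} (k : Fin N → ℂ) (β : Fin N → Fin n → ℂ) (x t : ℝ) :
    List (ℂ × (Fin n ⊕ Unit → ℂ)) :=
  List.ofFn fun m : Fin N => (k m, seed x t (k m) (β m))

/-- The commutator with `Σ₃` doubles the upper right block. -/
lemma nSoliton_apply {n N : ℕ} (k : Fin N → ℂ) (β : Fin N → Fin n → ℂ) (x t : ℝ) (i : Fin n) :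
    nSoliton k β x t i
      = 2 * Complex.I * dressCoeff (seedList k β x t) (Sum.inl i) (Sum.inr ()) := by
  have e : laxPotential k β x t = Complex.I • (sigma3 n * dressCoeff (seedList k β x t)
      - dressCoeff (seedList k β x t) * sigma3 n) := by
    rw [seedList, dressCoeff_ofFn, Finset.mul_sum, Finset.sum_mul, ← Finset.sum_sub_distrib,
      Finset.smul_sum]
    refine Finset.sum_congr rfl fun j _ => ?_
    simp only [dressTerm, laxProj, mul_smul_comm, smul_mul_assoc, ← smul_sub, smul_smul]
  rw [nSoliton, e]
  simp [Matrix.mul_apply, sigma3, fromBlocks_apply₁₁, Matrix.one_apply, Fintype.sum_sum_type]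
  ring

theorem nSoliton_comp_perm {n N : ℕ} (S : SolitonData n N) (τ : Equiv.Perm (Fin N)) :
    nSoliton (S.k ∘ τ) (S.β ∘ τ) = S.field := by
  funext x t i
  rw [SolitonData.field, nSoliton_apply, nSoliton_apply]
  suffices h : dressCoeff (seedList S.k S.β x t) = dressCoeff (seedList (S.k ∘ τ) (S.β ∘ τ) x t) by
    rw [h]
  refine dressCoeff_perm ?_ ?_ ?_
  · exact (Equiv.Perm.ofFn_comp_perm τ fun m => (S.k m, seed x t (S.k m) (S.β m))).symm
  · simp only [seedList, List.forall_mem_ofFn_iff]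
    exact S.im_pos
  · simp only [seedList]
    rw [List.pairwise_ofFn]
    exact fun i j h => S.k_injective.ne h.ne

/-! ### Partial fractions of the dressing factor -/

section PartialFractions

variable {ι : Type*} [Fintype ι] [DecidableEq ι]

lemma blaschke_conj_mul {k z : ℂ} (h : z ≠ k) (h' : z ≠ conj k) :
    blaschke k (conj z) * conj (blaschke k z) = 1 := by
  have h1 : conj z - conj k ≠ 0 := by rw [← map_sub]; exact (map_ne_zero _).2 (sub_ne_zero.2 h)
  have h2 : conj z - k ≠ 0 := sub_ne_zero.2 fun e => h' (by rw [← e, Complex.conj_conj])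
  simp only [blaschke, map_div₀, map_sub, Complex.conj_conj]
  field_simp

/-- Each factor contributes `f(z^*) · conj (f(z)) = 1`, so the product telescopes from the inside.
-/
lemma dress_conj_mul_conjTranspose (L : List (ℂ × (ι → ℂ))) {z : ℂ}
    (h : ∀ s ∈ L, z ≠ s.1 ∧ z ≠ conj s.1) : dress L (conj z) * (dress L z)ᴴ = 1 := by
  induction L using List.reverseRecOn with
  | nil => simp
  | append_singleton L s ih =>
    have hs := h s (by simp)
    rw [dress_append_singleton, dress_append_singleton, conjTranspose_mul, conjTranspose_dressFactor,
      dressFactor, mul_assoc, ← mul_assoc (scaleLine _ _), scaleLine_mul,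
      blaschke_conj_mul hs.1 hs.2, scaleLine_one, one_mul]
    exact ih fun t ht => h t (by simp [ht])

/-- The factor of `s` scales the line of its own dressed vector by `f(k) = 0`, and later factors act
on zero. These conditions will determine the residues. -/
lemma conjTranspose_dress_mulVec_eq_zero {L : List (ℂ × (ι → ℂ))} {s : ℂ × (ι → ℂ)}
    (hs : s ∈ L) : (dress L s.1)ᴴ *ᵥ s.2 = 0 := by
  induction L using List.reverseRecOn with
  | nil => simp at hs
  | append_singleton L r ih =>
    rw [dress_append_singleton, conjTranspose_mul, ← mulVec_mulVec]
    rcases List.mem_append.1 hs with h | h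
    · rw [ih h, mulVec_zero]
    · obtain rfl := List.mem_singleton.1 h
      rw [conjTranspose_dressFactor]
      have : blaschke s.1 s.1 = 0 := by simp [blaschke]
      rw [this, map_zero, scaleLine_mulVec]
      by_cases h0 : (dress L s.1)ᴴ *ᵥ s.2 = 0
      · simp [h0]
      · rw [inv_mul_cancel₀ (star_dotProduct_self_ne_zero h0)]; module

lemma ofFn_succ_eq_append {α : Type*} {N : ℕ} (F : Fin (N + 1) → α) :
    List.ofFn F = List.ofFn (fun i => F (Fin.castSucc i)) ++ [F (Fin.last N)] := by
  rw [List.ofFn_succ_last]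

/-- A new factor creates a pole at `k^*` whose residue is a multiple of `D(k^*) ζ ζ†`. As `ζ = D(k)†
v` and `D(k^*) D(k)† = 1`, its column space is the line of the undressed vector `v`, not of a
dressed one. -/
lemma exists_partialFractions {N : ℕ} (F : Fin N → ℂ × (ι → ℂ)) (him : ∀ j, 0 < (F j).1.im)
    (hF : Function.Injective fun j => (F j).1) (hv : ∀ j, (F j).2 ≠ 0) :
    ∃ X : Fin N → ι → ℂ, (∀ z, (∀ j, z ≠ conj (F j).1) → dress (List.ofFn F) z
        = 1 + ∑ j, (z - conj (F j).1)⁻¹ • vecMulVec (F j).2 (X j)) ∧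
      dressCoeff (List.ofFn F) = -∑ j, vecMulVec (F j).2 (X j) := by
  induction N with
  | zero => exact ⟨fun _ => 0, fun z _ => by simp, by simp⟩
  | succ N ih =>
    obtain ⟨X, hX, hX'⟩ := ih (fun i => F (Fin.castSucc i)) (fun j => him _)
      (hF.comp (Fin.castSucc_injective N)) (fun j => hv _)
    set L := List.ofFn (fun i => F (Fin.castSucc i)) with hL
    set k := (F (Fin.last N)).1
    set v := (F (Fin.last N)).2
    have hlt : ∀ i : Fin N, k ≠ (F (Fin.castSucc i)).1 := fun i =>
      hF.ne (Fin.castSucc_lt_last i).ne'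
    have him' : ∀ i j, (F i).1 ≠ conj (F j).1 := fun i j e => by
      have h1 := him i
      have h2 := him j
      rw [e, Complex.conj_im] at h1
      linarith
    have hunit := dress_conj_mul_conjTranspose L (z := k) (by
      rw [hL, List.forall_mem_ofFn_iff]
      exact fun i => ⟨hlt i, him' _ _⟩)
    set ζ := (dress L k)ᴴ *ᵥ v with hζ
    have hvζ : dress L (conj k) *ᵥ ζ = v := by rw [hζ, mulVec_mulVec, hunit, one_mulVec]
    have hζ0 : ζ ≠ 0 := fun h => hv (Fin.last N) (by
      rw [h, mulVec_zero] at hvζ; exact hvζ.symm)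
    have hcj : ∀ i : Fin N, conj k ≠ conj (F (Fin.castSucc i)).1 := fun i h =>
      hlt i ((starRingEnd ℂ).injective h)
    set P := star ζ ⬝ᵥ ζ with hP
    have hP0 : P ≠ 0 := star_dotProduct_self_ne_zero hζ0
    have hD : ∀ z, (∀ j : Fin N, z ≠ conj (F (Fin.castSucc j)).1) → dress L z *ᵥ ζ
        = ζ + ∑ j : Fin N, ((z - conj (F (Fin.castSucc j)).1)⁻¹ * (X j ⬝ᵥ ζ)) •
            (F (Fin.castSucc j)).2 := fun z hz => by
      rw [hX z hz, add_mulVec, one_mulVec, sum_mulVec]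
      congr 1
      refine Finset.sum_congr rfl fun j _ => ?_
      rw [smul_mulVec, vecMulVec_mulVec, op_smul_eq_smul, smul_smul]
    have hve := hD _ hcj
    rw [hvζ] at hve
    -- The rows come from splitting `1 / ((z - k_j^*)(z - k^*))` between its two poles.
    refine ⟨Fin.snoc (fun j => X j + (((k - conj k) / P) * ((conj k - conj (F (Fin.castSucc j)).1)⁻¹
      * (X j ⬝ᵥ ζ))) • star ζ) (-((k - conj k) / P) • star ζ), fun z hz => ?_, ?_⟩
    · have hz' : ∀ j : Fin N, z ≠ conj (F (Fin.castSucc j)).1 := fun j => hz _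
      have hzk : z - conj k ≠ 0 := sub_ne_zero.2 (hz (Fin.last N))
      rw [ofFn_succ_eq_append, dress_append_singleton, Fin.sum_univ_castSucc]
      simp only [Fin.snoc_castSucc, Fin.snoc_last]
      rw [dressFactor, scaleLine, mul_add, mul_one, mul_smul_comm, lineProj, mul_smul_comm,
        mul_vecMulVec, hD z hz', hX z hz', blaschke_sub_one (hz (Fin.last N))]
      change _ + (-(k - conj k) * (z - conj k)⁻¹) • P⁻¹ • _ = _ + (_ + (z - conj k)⁻¹ • vecMulVec v _)
      rw [add_assoc, ← sub_eq_zero]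
      have e : ∀ j : Fin N, (z - conj (F (Fin.castSucc j)).1)⁻¹ * (conj k - conj (F (Fin.castSucc j)).1)⁻¹
          = ((conj k - conj (F (Fin.castSucc j)).1)⁻¹ - (z - conj (F (Fin.castSucc j)).1)⁻¹)
            * (z - conj k)⁻¹ := fun j => by
        have h1 := sub_ne_zero.2 (hz' j)
        have h2 := sub_ne_zero.2 (hcj j)
        field_simp
        ring
      ext a b
      have hva := congrFun hve a
      simp only [Pi.add_apply, Finset.sum_apply, Pi.smul_apply, smul_eq_mul] at hva
      simp only [Matrix.sub_apply, Matrix.add_apply, Matrix.sum_apply, Matrix.smul_apply,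
        vecMulVec_apply, Pi.add_apply, Pi.smul_apply, smul_eq_mul, Matrix.zero_apply,
        Finset.sum_apply, hva]
      have e2 : ∀ j : Fin N, (z - conj (F (Fin.castSucc j)).1)⁻¹ * ((F (Fin.castSucc j)).2 a *
          (X j b + (k - conj k) / P * ((conj k - conj (F (Fin.castSucc j)).1)⁻¹ * X j ⬝ᵥ ζ) * star ζ b))
          = (z - conj (F (Fin.castSucc j)).1)⁻¹ * ((F (Fin.castSucc j)).2 a * X j b)
            + (k - conj k) / P * (z - conj k)⁻¹ * star ζ b *
              ((conj k - conj (F (Fin.castSucc j)).1)⁻¹ * (X j ⬝ᵥ ζ) * (F (Fin.castSucc j)).2 a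
                - (z - conj (F (Fin.castSucc j)).1)⁻¹ * (X j ⬝ᵥ ζ) * (F (Fin.castSucc j)).2 a) :=
        fun j => by
          linear_combination ((F (Fin.castSucc j)).2 a * (k - conj k) / P * (X j ⬝ᵥ ζ) * star ζ b)
            * e j
      simp only [e2, Finset.sum_add_distrib, ← Finset.mul_sum, Finset.sum_sub_distrib]
      ring
    · rw [ofFn_succ_eq_append, dressCoeff_append_singleton, hX', Fin.sum_univ_castSucc]
      simp only [Fin.snoc_castSucc, Fin.snoc_last, dressTerm]
      change _ + (k - conj k) • lineProj ζ = -(_ + vecMulVec v _)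
      rw [lineProj]
      ext a b
      have hva := congrFun hve a
      simp only [Pi.add_apply, Finset.sum_apply, Pi.smul_apply, smul_eq_mul] at hva
      simp only [Matrix.add_apply, Matrix.neg_apply, Matrix.sum_apply, Matrix.smul_apply,
        vecMulVec_apply, Pi.add_apply, Pi.smul_apply, smul_eq_mul, hva]
      have e2 : ∀ j : Fin N, (F (Fin.castSucc j)).2 a *
          (X j b + (k - conj k) / P * ((conj k - conj (F (Fin.castSucc j)).1)⁻¹ * X j ⬝ᵥ ζ) * star ζ b)
          = (F (Fin.castSucc j)).2 a * X j b + (k - conj k) / P * star ζ b *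
              ((conj k - conj (F (Fin.castSucc j)).1)⁻¹ * (X j ⬝ᵥ ζ) * (F (Fin.castSucc j)).2 a) :=
        fun j => by ring
      simp only [e2, Finset.sum_add_distrib, ← Finset.mul_sum]
      change _ + (k - conj k) * (P⁻¹ * _) = _
      field_simp
      ring

end PartialFractions

/-! ### The residue as a product of matrices -/

section CauchyGram

variable {ι : Type*} [Fintype ι] {N : ℕ}

/-- The matrix `(v_i† v_j / (k_i - k_j^*))_{ij}`, where the vectors `v_j` are the columns of `V`. -/
def cauchyGram (k : Fin N → ℂ) (V : Matrix ι (Fin N) ℂ) : Matrix (Fin N) (Fin N) ℂ :=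
  of fun i j => (k i - conj (k j))⁻¹ * (Vᴴ * V) i j

/-- The matrices `V (K^*)^m M⁻¹ V†` with `K = diag(k_j)` and `M` the matrix `cauchyGram k V`. -/
def moment (k : Fin N → ℂ) (V : Matrix ι (Fin N) ℂ) (m : ℕ) : Matrix ι ι ℂ :=
  V * diagonal (fun j => conj (k j)) ^ m * ((cauchyGram k V)⁻¹ * Vᴴ)

variable {k : Fin N → ℂ} (him : ∀ j, 0 < (k j).im)
include him

lemma sub_conj_ne_zero_of_im_pos (i j : Fin N) : k i - conj (k j) ≠ 0 := sub_ne_zero.2 fun e => by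
  have h1 := him i
  have h2 := him j
  rw [e, Complex.conj_im] at h1
  linarith

lemma cauchyGram_lyapunov (V : Matrix ι (Fin N) ℂ) :
    diagonal k * cauchyGram k V - cauchyGram k V * diagonal (fun j => conj (k j)) = Vᴴ * V := by
  ext i j
  have := sub_conj_ne_zero_of_im_pos him i j
  rw [Matrix.sub_apply, diagonal_mul, mul_diagonal, cauchyGram, of_apply]
  field_simp

omit him in
lemma conjTranspose_cauchyGram (V : Matrix ι (Fin N) ℂ) :
    (cauchyGram k V)ᴴ = -cauchyGram k V := by
  ext i j
  have h : star ((Vᴴ * V) j i) = (Vᴴ * V) i j := by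
    rw [← conjTranspose_apply, conjTranspose_mul, conjTranspose_conjTranspose]
  simp only [conjTranspose_apply, cauchyGram, of_apply, Matrix.neg_apply, star_mul', star_inv₀, star_sub, h]
  simp only [Complex.star_def, Complex.conj_conj]
  rw [← neg_sub (k i), inv_neg, neg_mul]

/-- If `M w = 0`, then `w† M = 0` as `M` is skew-Hermitian, and the identity `K M - M K^* = V† V`
gives `V w = 0`, hence `M K^* w = 0`. A nonzero kernel would thus be invariant under `K^*` and
contain an eigenvector, which is a multiple of a basis vector since the `k_j` are distinct; then `V`
would have a zero column. -/
lemma isUnit_cauchyGram (hk : Function.Injective k) {V : Matrix ι (Fin N) ℂ}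
    (hV : ∀ j, (fun i => V i j) ≠ 0) : IsUnit (cauchyGram k V) := by
  set M := cauchyGram k V with hM
  set C : Matrix (Fin N) (Fin N) ℂ := diagonal (fun j => conj (k j)) with hC
  have hlyap := cauchyGram_lyapunov him V
  rw [← mulVec_injective_iff_isUnit]
  change Function.Injective (toLin' M)
  rw [← LinearMap.ker_eq_bot]
  set W := LinearMap.ker (toLin' M) with hW
  -- the kernel is contained in the kernel of `V` and invariant under `C`
  have hVw : ∀ w, M *ᵥ w = 0 → V *ᵥ w = 0 := fun w hw => by
    have h0 : star w ᵥ* M = 0 := by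
      have := star_mulVec M w
      rw [hw, star_zero, hM, conjTranspose_cauchyGram, vecMul_neg, ← hM] at this
      simpa using this.symm
    have h1 : star w ⬝ᵥ ((Vᴴ * V) *ᵥ w) = 0 := by
      rw [← hlyap, sub_mulVec, ← mulVec_mulVec, ← mulVec_mulVec, hw, mulVec_zero, zero_sub,
        dotProduct_neg, dotProduct_mulVec, h0, zero_dotProduct, neg_zero]
    by_contra hne
    refine star_dotProduct_self_ne_zero hne ?_
    rwa [star_mulVec, ← dotProduct_mulVec, mulVec_mulVec]
  have hCw : ∀ w, M *ᵥ w = 0 → M *ᵥ (C *ᵥ w) = 0 := fun w hw => by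
    have : (Vᴴ * V) *ᵥ w = 0 := by rw [← mulVec_mulVec, hVw w hw, mulVec_zero]
    rw [← hlyap, sub_mulVec, ← mulVec_mulVec, ← mulVec_mulVec, hw, mulVec_zero, zero_sub] at this
    exact neg_eq_zero.1 this
  by_contra hne
  have : Nontrivial W := Submodule.nontrivial_iff_ne_bot.2 hne
  have hmem : ∀ w ∈ W, toLin' C w ∈ W := fun w hw => by
    rw [hW, LinearMap.mem_ker, toLin'_apply] at hw ⊢
    exact hCw w hw
  obtain ⟨μ, hμ⟩ := Module.End.exists_eigenvalue ((toLin' C).restrict hmem)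
  obtain ⟨⟨w, hw⟩, hwμ, hw0⟩ := hμ.exists_hasEigenvector
  rw [Module.End.mem_eigenspace_iff] at hwμ
  have hwC : ∀ j, conj (k j) * w j = μ * w j := fun j => by
    have := congrFun (congrArg Subtype.val hwμ) j
    simpa [hC, mulVec_diagonal] using this
  have hwne : w ≠ 0 := fun h => hw0 (Subtype.ext h)
  obtain ⟨j, hj⟩ := Function.ne_iff.1 hwne
  have hμj : μ = conj (k j) := (mul_right_cancel₀ hj (hwC j)).symm
  have hwi : w = Pi.single j (w j) := by
    ext i
    by_cases hij : i = j
    · subst hij; simp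
    · rw [Pi.single_eq_of_ne hij]
      have h1 := hwC i
      rw [hμj, ← sub_eq_zero, ← sub_mul, mul_eq_zero, sub_eq_zero] at h1
      exact h1.resolve_left fun h => hij (hk ((starRingEnd ℂ).injective h))
  have hVz := hVw w (by rwa [hW, LinearMap.mem_ker, toLin'_apply] at hw)
  rw [hwi, mulVec_single] at hVz
  refine hV j (funext fun i => ?_)
  have := congrFun hVz i
  exact (show V i j = 0 ∨ w j = 0 by simpa using this).resolve_right hj

/-- The residue of the dressing factor in closed form. -/
lemma dressCoeff_eq_moment [DecidableEq ι] (hk : Function.Injective k) {V : Matrix ι (Fin N) ℂ}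
    (hV : ∀ j, (fun i => V i j) ≠ 0) :
    dressCoeff (List.ofFn fun j => (k j, fun i => V i j)) = moment k V 0 := by
  obtain ⟨X, hX, hX'⟩ := exists_partialFractions (fun j => (k j, fun i => V i j)) him hk hV
  have hu := isUnit_cauchyGram him hk hV
  have hVX : ∑ j, vecMulVec (fun i => V i j) (X j) = V * of X := by
    ext a b
    simp [Matrix.sum_apply, vecMulVec_apply, Matrix.mul_apply]
  -- The adjoints of the conditions `D(k_j)† v_j = 0`, collected as rows, form a linear system for
  -- the residues with matrix `M`.
  have hMX : Vᴴ + cauchyGram k V * of X = 0 := by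
    ext j b
    have h1 := conjTranspose_dress_mulVec_eq_zero (L := List.ofFn fun j => (k j, fun i => V i j))
      (s := (k j, fun i => V i j)) (List.mem_ofFn.2 ⟨j, rfl⟩)
    rw [hX (k j) fun i => sub_ne_zero.1 (sub_conj_ne_zero_of_im_pos him j i)] at h1
    have h2 := congrArg star h1
    rw [star_mulVec, conjTranspose_conjTranspose, star_zero, vecMul_add, vecMul_one,
      vecMul_sum] at h2
    have h3 := congrFun h2 b
    simp only [Pi.add_apply, Finset.sum_apply, vecMul_smul, vecMul_vecMulVec, Pi.smul_apply,
      smul_eq_mul, Pi.star_apply, Pi.zero_apply] at h3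
    rw [Matrix.add_apply, Matrix.mul_apply, Matrix.zero_apply, conjTranspose_apply, ← h3]
    congr 1
    refine Finset.sum_congr rfl fun i _ => ?_
    rw [cauchyGram, of_apply, of_apply, mul_assoc]
    rfl
  have hXe : of X = -((cauchyGram k V)⁻¹ * Vᴴ) := by
    rw [eq_neg_of_add_eq_zero_left hMX, Matrix.mul_neg, neg_neg, ← Matrix.mul_assoc,
      nonsing_inv_mul _ ((isUnit_iff_isUnit_det _).1 hu), Matrix.one_mul]
  rw [hX', moment, pow_zero, Matrix.mul_one]
  simp only
  rw [hVX, hXe, Matrix.mul_neg, neg_neg]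

/-- The identity `K M - M K^* = V† V` between two copies of `M⁻¹`. It moves `K` through `M⁻¹`,
turning it into `K^*` plus a term which splits a moment into a product of two. -/
lemma inv_cauchyGram_mul_diagonal (hk : Function.Injective k) {V : Matrix ι (Fin N) ℂ}
    (hV : ∀ j, (fun i => V i j) ≠ 0) :
    (cauchyGram k V)⁻¹ * diagonal k = diagonal (fun j => conj (k j)) * (cauchyGram k V)⁻¹
      + (cauchyGram k V)⁻¹ * Vᴴ * (V * (cauchyGram k V)⁻¹) := by
  have hu := (isUnit_iff_isUnit_det _).1 (isUnit_cauchyGram him hk hV)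
  have h := cauchyGram_lyapunov him V
  have h2 : diagonal k * cauchyGram k V
      = Vᴴ * V + cauchyGram k V * diagonal (fun j => conj (k j)) := by rw [← h]; abel
  set M := cauchyGram k V
  calc M⁻¹ * diagonal k = M⁻¹ * (diagonal k * M) * M⁻¹ := by
        rw [Matrix.mul_assoc, Matrix.mul_assoc, mul_nonsing_inv _ hu, Matrix.mul_one]
    _ = _ := by
        rw [h2, Matrix.mul_add, ← Matrix.mul_assoc M⁻¹ M, nonsing_inv_mul _ hu, Matrix.one_mul,
          Matrix.add_mul, add_comm]
        simp only [Matrix.mul_assoc]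

end CauchyGram

/-! ### Entrywise calculus of matrix functions -/

section EntryCalculus

variable {l m p : Type*}

/-- `f` has the derivative `f'` at `t`, entry by entry. -/
def HasEntryDerivAt (f : ℝ → Matrix l m ℂ) (f' : Matrix l m ℂ) (t : ℝ) : Prop :=
  ∀ i j, HasDerivAt (fun s => f s i j) (f' i j) t

namespace HasEntryDerivAt

variable {f g : ℝ → Matrix l m ℂ} {f' g' : Matrix l m ℂ} {t : ℝ}

lemma congr_deriv (hf : HasEntryDerivAt f f' t) (h : f' = g') : HasEntryDerivAt f g' t := h ▸ hf

lemma const (A : Matrix l m ℂ) : HasEntryDerivAt (fun _ => A) 0 t := fun i j =>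
  hasDerivAt_const t (A i j)

lemma add (hf : HasEntryDerivAt f f' t) (hg : HasEntryDerivAt g g' t) :
    HasEntryDerivAt (fun s => f s + g s) (f' + g') t := fun i j => (hf i j).add (hg i j)

lemma smul (hf : HasEntryDerivAt f f' t) (c : ℂ) :
    HasEntryDerivAt (fun s => c • f s) (c • f') t := fun i j => (hf i j).const_mul c

lemma mul [Fintype m] {g : ℝ → Matrix m p ℂ} {g' : Matrix m p ℂ} (hf : HasEntryDerivAt f f' t)
    (hg : HasEntryDerivAt g g' t) :
    HasEntryDerivAt (fun s => f s * g s) (f' * g t + f t * g') t := fun i j => by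
  simp only [Matrix.add_apply, Matrix.mul_apply, ← Finset.sum_add_distrib]
  exact HasDerivAt.fun_sum fun k _ => (hf i k).mul (hg k j)

lemma mul_const [Fintype m] (hf : HasEntryDerivAt f f' t) (A : Matrix m p ℂ) :
    HasEntryDerivAt (fun s => f s * A) (f' * A) t :=
  (hf.mul (const A)).congr_deriv (by simp)

lemma conjTranspose (hf : HasEntryDerivAt f f' t) :
    HasEntryDerivAt (fun s => (f s)ᴴ) f'ᴴ t := fun i j => (hf j i).star

lemma unique (hf : HasEntryDerivAt f f' t) (hg : HasEntryDerivAt f g' t) : f' = g' := by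
  ext i j
  exact (hf i j).unique (hg i j)

end HasEntryDerivAt

variable {E : Type*} [NormedAddCommGroup E] [NormedSpace ℝ E]

/-- `f` is smooth, entry by entry. -/
def EntrySmooth (f : E → Matrix l m ℂ) : Prop :=
  ∀ i j, ContDiff ℝ (⊤ : ℕ∞) fun x => f x i j

namespace EntrySmooth

variable {f : E → Matrix l m ℂ}

lemma mul [Fintype m] {g : E → Matrix m p ℂ} (hf : EntrySmooth f) (hg : EntrySmooth g) :
    EntrySmooth fun x => f x * g x := fun i j => by
  simp only [Matrix.mul_apply]
  exact ContDiff.sum fun k _ => (hf i k).mul (hg k j)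

lemma conjTranspose (hf : EntrySmooth f) : EntrySmooth fun x => (f x)ᴴ := fun i j =>
  Complex.conjCLE.contDiff.comp (hf j i)

lemma comp {F : Type*} [NormedAddCommGroup F] [NormedSpace ℝ F] (hf : EntrySmooth f) {g : F → E}
    (hg : ContDiff ℝ (⊤ : ℕ∞) g) : EntrySmooth fun x => f (g x) := fun i j => (hf i j).comp hg

variable [Fintype m] [DecidableEq m] {g : E → Matrix m m ℂ}

lemma det (hg : EntrySmooth g) : ContDiff ℝ (⊤ : ℕ∞) fun x => (g x).det := by
  simp only [Matrix.det_apply]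
  exact ContDiff.sum fun σ _ => (contDiff_prod fun i _ => hg _ _).const_smul _

lemma inv (hg : EntrySmooth g) (hu : ∀ x, IsUnit (g x)) : EntrySmooth fun x => (g x)⁻¹ := fun i j => by
  have h0 : ∀ x, (g x).det ≠ 0 := fun x => ((isUnit_iff_isUnit_det _).1 (hu x)).ne_zero
  simp only [Matrix.inv_def, Matrix.smul_apply, Ring.inverse_eq_inv', smul_eq_mul, adjugate_apply]
  refine (hg.det.inv h0).mul (det fun a b => ?_)
  simp only [updateRow_apply]
  split_ifs
  · exact contDiff_const
  · exact hg a b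

end EntrySmooth

lemma HasEntryDerivAt.inv [Fintype m] [DecidableEq m] {g : ℝ → Matrix m m ℂ} {g' : Matrix m m ℂ}
    {t : ℝ} (hs : EntrySmooth fun s => (g s)⁻¹) (hg : HasEntryDerivAt g g' t)
    (hu : ∀ s, IsUnit (g s)) :
    HasEntryDerivAt (fun s => (g s)⁻¹) (-((g t)⁻¹ * g' * (g t)⁻¹)) t := by
  have hd : ∀ s, IsUnit (g s).det := fun s => (isUnit_iff_isUnit_det _).1 (hu s)
  have h1 : HasEntryDerivAt (fun s => (g s)⁻¹) (of fun i j => deriv (fun s => (g s)⁻¹ i j) t) t :=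
    fun i j => ((hs i j).differentiable (by simp) t).hasDerivAt
  refine h1.congr_deriv ?_
  set D := of fun i j => deriv (fun s => (g s)⁻¹ i j) t
  -- Differentiability is known from smoothness; the value follows by differentiating `g⁻¹ g = 1`.
  have h2 := (h1.mul hg).congr_deriv (g' := D * g t + (g t)⁻¹ * g') rfl
  have h3 : (fun s => (g s)⁻¹ * g s) = fun _ => 1 := funext fun s => nonsing_inv_mul _ (hd s)
  rw [h3] at h2
  have h4 : D * g t = -((g t)⁻¹ * g') := eq_neg_of_add_eq_zero_left (h2.unique (.const 1))
  calc D = D * g t * (g t)⁻¹ := by rw [Matrix.mul_assoc, mul_nonsing_inv _ (hd t), Matrix.mul_one]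
    _ = _ := by rw [h4, Matrix.neg_mul]

end EntryCalculus

/-! ### The derivatives of the moments -/

section Moments

variable {ι : Type*} [Fintype ι] {N : ℕ} {k : Fin N → ℂ}

lemma EntrySmooth.cauchyGram {E : Type*} [NormedAddCommGroup E] [NormedSpace ℝ E]
    {V : E → Matrix ι (Fin N) ℂ} (hV : EntrySmooth V) :
    EntrySmooth fun x => cauchyGram k (V x) := fun i j =>
  contDiff_const.mul (hV.conjTranspose.mul hV i j)

variable (him : ∀ j, 0 < (k j).im) (hk : Function.Injective k)
include him hk

lemma entrySmooth_moment {E : Type*} [NormedAddCommGroup E] [NormedSpace ℝ E]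
    {V : E → Matrix ι (Fin N) ℂ} (hV : EntrySmooth V) (hV0 : ∀ x j, (fun i => V x i j) ≠ 0) (m : ℕ) :
    EntrySmooth fun x => moment k (V x) m := by
  have h1 : EntrySmooth fun x => V x * diagonal (fun j => conj (k j)) ^ m :=
    hV.mul fun _ _ => contDiff_const
  have h2 : EntrySmooth fun x => (cauchyGram k (V x))⁻¹ :=
    hV.cauchyGram.inv fun x => isUnit_cauchyGram him hk (hV0 x)
  exact h1.mul (h2.mul hV.conjTranspose)

variable {V : ℝ → Matrix ι (Fin N) ℂ} (hV : EntrySmooth V) (hV0 : ∀ x j, (fun i => V x i j) ≠ 0)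
  {T : Matrix ι ι ℂ} (hT : Tᴴ = T) {s : ℝ}
include hV hV0 hT

lemma hasEntryDerivAt_moment_x
    (hd : HasEntryDerivAt V (-Complex.I • (T * V s * diagonal fun j => conj (k j))) s) (m : ℕ) :
    HasEntryDerivAt (fun s => moment k (V s) m)
      (-Complex.I • (T * moment k (V s) (m + 1) - moment k (V s) (m + 1) * T
        + moment k (V s) m * (T * moment k (V s) 0 - moment k (V s) 0 * T))) s := by
  have hrel := inv_cauchyGram_mul_diagonal him hk (hV0 s)
  have hu : ∀ s, IsUnit (cauchyGram k (V s)) := fun x => isUnit_cauchyGram him hk (hV0 x)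
  have hMs := hV.cauchyGram.inv hu
  have hH := hd.conjTranspose.congr_deriv
    (g' := Complex.I • (diagonal k * (V s)ᴴ * T)) (by
      simp [conjTranspose_smul, conjTranspose_mul, hT, diagonal_conjTranspose, Pi.star_def,
        Matrix.mul_assoc])
  -- The derivative of `V† V` carries the factor `k_i - k_j^*`, which cancels the denominator of
  -- `M`.
  have hM : HasEntryDerivAt (fun s => cauchyGram k (V s)) (Complex.I • ((V s)ᴴ * T * V s)) s := by
    intro i j
    have h := ((hH.mul hd) i j).const_mul (k i - conj (k j))⁻¹
    refine h.congr_deriv ?_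
    have := sub_conj_ne_zero_of_im_pos him i j
    rw [Matrix.smul_mul, Matrix.mul_smul, Matrix.mul_assoc (diagonal k), Matrix.mul_assoc (diagonal k),
      ← Matrix.mul_assoc (V s)ᴴ, ← Matrix.mul_assoc (V s)ᴴ]
    rw [Matrix.add_apply, Matrix.smul_apply, Matrix.smul_apply, Matrix.smul_apply, diagonal_mul,
      mul_diagonal]
    simp only [smul_eq_mul]
    field_simp
    ring
  unfold moment
  generalize diagonal (fun j => conj (k j)) = C at hd hrel ⊢
  have hr : ∀ A : Matrix (Fin N) ι ℂ, (cauchyGram k (V s))⁻¹ * (diagonal k * A)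
      = C * ((cauchyGram k (V s))⁻¹ * A)
        + (cauchyGram k (V s))⁻¹ * ((V s)ᴴ * (V s * ((cauchyGram k (V s))⁻¹ * A))) := fun A => by
    rw [← Matrix.mul_assoc, hrel]
    simp only [Matrix.add_mul, Matrix.mul_assoc]
  have hCm : ∀ A : Matrix (Fin N) ι ℂ, C * (C ^ m * A) = C ^ m * (C * A) := fun A => by
    rw [← Matrix.mul_assoc, ← Matrix.mul_assoc, ← pow_succ', pow_succ]
  refine ((hd.mul_const (C ^ m)).mul ((HasEntryDerivAt.inv hMs hM hu).mul hH)).congr_deriv ?_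
  simp only [Matrix.mul_add, Matrix.mul_sub, Matrix.smul_mul,
    Matrix.mul_smul, Matrix.neg_mul, Matrix.mul_neg, Matrix.mul_assoc, hr, hCm, pow_succ, pow_zero,
    Matrix.mul_one]
  module

lemma hasEntryDerivAt_moment_t
    (hd : HasEntryDerivAt V (-(2 * Complex.I) • (T * V s * (diagonal fun j => conj (k j)) ^ 2)) s) (m : ℕ) :
    HasEntryDerivAt (fun s => moment k (V s) m)
      (-(2 * Complex.I) • (T * moment k (V s) (m + 2) - moment k (V s) (m + 2) * T
        + moment k (V s) (m + 1) * (T * moment k (V s) 0 - moment k (V s) 0 * T)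
        + moment k (V s) m * (T * moment k (V s) 1 - moment k (V s) 1 * T)
        + moment k (V s) m * moment k (V s) 0 * (T * moment k (V s) 0 - moment k (V s) 0 * T))) s := by
  have hrel := inv_cauchyGram_mul_diagonal him hk (hV0 s)
  have hu : ∀ s, IsUnit (cauchyGram k (V s)) := fun x => isUnit_cauchyGram him hk (hV0 x)
  have hMs := hV.cauchyGram.inv hu
  have hH := hd.conjTranspose.congr_deriv
    (g' := (2 * Complex.I) • (diagonal k ^ 2 * (V s)ᴴ * T)) (by
      simp [conjTranspose_smul, conjTranspose_mul, hT, diagonal_conjTranspose, Pi.star_def,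
        Matrix.mul_assoc])
  -- Here the factor is `k_i² - (k_j^*)²`, and `k_i + k_j^*` survives the cancellation.
  have hM : HasEntryDerivAt (fun s => cauchyGram k (V s)) ((2 * Complex.I) •
      (diagonal k * ((V s)ᴴ * T * V s) + (V s)ᴴ * T * V s * diagonal fun j => conj (k j))) s := by
    intro i j
    have h := ((hH.mul hd) i j).const_mul (k i - conj (k j))⁻¹
    refine h.congr_deriv ?_
    have := sub_conj_ne_zero_of_im_pos him i j
    rw [diagonal_pow, diagonal_pow, Matrix.smul_mul, Matrix.mul_smul,
      Matrix.mul_assoc (diagonal _), Matrix.mul_assoc (diagonal _),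
      ← Matrix.mul_assoc (V s)ᴴ, ← Matrix.mul_assoc (V s)ᴴ]
    rw [Matrix.add_apply, Matrix.smul_apply, Matrix.smul_apply, Matrix.smul_apply,
      Matrix.add_apply, diagonal_mul, diagonal_mul, mul_diagonal, mul_diagonal]
    simp only [smul_eq_mul, Pi.pow_apply]
    field_simp
    ring
  unfold moment
  generalize diagonal (fun j => conj (k j)) = C at hd hrel hM ⊢
  have hr : ∀ A : Matrix (Fin N) ι ℂ, (cauchyGram k (V s))⁻¹ * (diagonal k * A)
      = C * ((cauchyGram k (V s))⁻¹ * A)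
        + (cauchyGram k (V s))⁻¹ * ((V s)ᴴ * (V s * ((cauchyGram k (V s))⁻¹ * A))) := fun A => by
    rw [← Matrix.mul_assoc, hrel]
    simp only [Matrix.add_mul, Matrix.mul_assoc]
  have hCm : ∀ A : Matrix (Fin N) ι ℂ, C * (C ^ m * A) = C ^ m * (C * A) := fun A => by
    rw [← Matrix.mul_assoc, ← Matrix.mul_assoc, ← pow_succ', pow_succ]
  refine ((hd.mul_const (C ^ m)).mul ((HasEntryDerivAt.inv hMs hM hu).mul hH)).congr_deriv ?_
  simp only [Matrix.add_mul, Matrix.mul_add, Matrix.mul_sub, Matrix.smul_mul,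
    Matrix.mul_smul, Matrix.neg_mul, Matrix.mul_neg, Matrix.mul_assoc, hr, hCm, pow_succ, pow_zero,
    Matrix.one_mul, Matrix.mul_one]
  module

end Moments

/-! ### The field solves the vector nonlinear Schroedinger equation -/

section Equation

variable {n N : ℕ}

lemma HasEntryDerivAt.toBlocks₁₁ {f : ℝ → Matrix (Fin n ⊕ Unit) (Fin n ⊕ Unit) ℂ}
    {f' : Matrix (Fin n ⊕ Unit) (Fin n ⊕ Unit) ℂ} {t : ℝ} (h : HasEntryDerivAt f f' t) :
    HasEntryDerivAt (fun s => (f s).toBlocks₁₁) f'.toBlocks₁₁ t := fun i j =>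
  h (Sum.inl i) (Sum.inl j)

lemma HasEntryDerivAt.toBlocks₁₂ {f : ℝ → Matrix (Fin n ⊕ Unit) (Fin n ⊕ Unit) ℂ}
    {f' : Matrix (Fin n ⊕ Unit) (Fin n ⊕ Unit) ℂ} {t : ℝ} (h : HasEntryDerivAt f f' t) :
    HasEntryDerivAt (fun s => (f s).toBlocks₁₂) f'.toBlocks₁₂ t := fun i j =>
  h (Sum.inl i) (Sum.inr j)

lemma sigma3_commutator (S : Matrix (Fin n ⊕ Unit) (Fin n ⊕ Unit) ℂ) :
    sigma3 n * S - S * sigma3 n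
      = fromBlocks 0 ((2 : ℂ) • S.toBlocks₁₂) (-(2 : ℂ) • S.toBlocks₂₁) 0 := by
  conv_lhs => rw [← fromBlocks_toBlocks S]
  rw [sigma3, fromBlocks_multiply, fromBlocks_multiply, sub_eq_add_neg, fromBlocks_neg,
    fromBlocks_add]
  congr 1
  · simp
  · simp; module
  · simp; module
  · simp

lemma toBlocks_mul_sigma3_commutator (R S : Matrix (Fin n ⊕ Unit) (Fin n ⊕ Unit) ℂ) :
    R * (sigma3 n * S - S * sigma3 n) = fromBlocks (-(2 : ℂ) • (R.toBlocks₁₂ * S.toBlocks₂₁))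
      ((2 : ℂ) • (R.toBlocks₁₁ * S.toBlocks₁₂)) (-(2 : ℂ) • (R.toBlocks₂₂ * S.toBlocks₂₁))
      ((2 : ℂ) • (R.toBlocks₂₁ * S.toBlocks₁₂)) := by
  rw [sigma3_commutator]
  conv_lhs => rw [← fromBlocks_toBlocks R]
  rw [fromBlocks_multiply]
  simp

lemma conjTranspose_sigma3 : (sigma3 n)ᴴ = sigma3 n := by
  simp [sigma3, fromBlocks_conjTranspose]

/-- The projectors are Hermitian and `k - k^*` is imaginary. This ties the lower left block to the
upper right one and makes the system for the field close. -/
lemma conjTranspose_dressCoeff {ι : Type*} [Fintype ι] [DecidableEq ι] (L : List (ℂ × (ι → ℂ))) :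
    (dressCoeff L)ᴴ = -dressCoeff L := by
  induction L using List.reverseRecOn with
  | nil => simp
  | append_singleton L s ih =>
    rw [dressCoeff_append_singleton, conjTranspose_add, ih, dressTerm, conjTranspose_smul,
      conjTranspose_lineProj, neg_add]
    congr 1
    rw [← neg_smul]
    congr 1
    simp

lemma toBlocks₁₁_mul (R S : Matrix (Fin n ⊕ Unit) (Fin n ⊕ Unit) ℂ) :
    (R * S).toBlocks₁₁ = R.toBlocks₁₁ * S.toBlocks₁₁ + R.toBlocks₁₂ * S.toBlocks₂₁ := by
  conv_lhs => rw [← fromBlocks_toBlocks R, ← fromBlocks_toBlocks S, fromBlocks_multiply,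
    toBlocks_fromBlocks₁₁]

/-- The matrix with the seed vectors as columns. -/
def seedMatrix (k : Fin N → ℂ) (β : Fin N → Fin n → ℂ) (x t : ℝ) :
    Matrix (Fin n ⊕ Unit) (Fin N) ℂ :=
  of fun i j => seed x t (k j) (β j) i

variable (k : Fin N → ℂ) (β : Fin N → Fin n → ℂ)

lemma entrySmooth_seedMatrix : EntrySmooth fun z : ℝ × ℝ => seedMatrix k β z.1 z.2 := by
  have h : ∀ c : ℂ, ContDiff ℝ (⊤ : ℕ∞) fun z : ℝ × ℝ => phase z.1 z.2 c := fun c => by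
    unfold phase
    exact (contDiff_const.mul (Complex.ofRealCLM.contDiff.comp contDiff_fst)).add
      (contDiff_const.mul (Complex.ofRealCLM.contDiff.comp contDiff_snd))
  rintro (i | i) j
  · exact ((contDiff_const.mul (h _)).cexp).mul contDiff_const
  · exact ((contDiff_const.mul (h _)).cexp).neg

lemma seed_ne_zero (x t : ℝ) (c : ℂ) (b : Fin n → ℂ) : seed x t c b ≠ 0 := fun h => by
  have := congrFun h (Sum.inr ())
  simp [seed] at this

lemma hasEntryDerivAt_seedMatrix_x (x t : ℝ) :
    HasEntryDerivAt (fun x => seedMatrix k β x t)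
      (-Complex.I • (sigma3 n * seedMatrix k β x t * diagonal fun j => conj (k j))) x := by
  have h : ∀ c : ℂ, HasDerivAt (fun x : ℝ => phase x t c) c x := fun c => by
    have := ((Complex.ofRealCLM.hasDerivAt (x := x)).const_mul c).add_const (2 * c ^ 2 * t)
    simpa [phase] using this
  rintro (i | i) j
  · refine ((((h _).const_mul (-Complex.I)).cexp).mul_const (β j i)).congr_deriv ?_
    rw [Matrix.smul_apply, mul_diagonal]
    simp [Matrix.mul_apply, sigma3, Matrix.one_apply, Fintype.sum_sum_type, seedMatrix, seed]
    ring
  · refine (((h _).const_mul Complex.I).cexp).fun_neg.congr_deriv ?_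
    rw [Matrix.smul_apply, mul_diagonal]
    simp [Matrix.mul_apply, sigma3, Fintype.sum_sum_type, seedMatrix, seed]
    ring

lemma hasEntryDerivAt_seedMatrix_t (x t : ℝ) :
    HasEntryDerivAt (fun t => seedMatrix k β x t)
      (-(2 * Complex.I) • (sigma3 n * seedMatrix k β x t * (diagonal fun j => conj (k j)) ^ 2)) t := by
  have h : ∀ c : ℂ, HasDerivAt (fun t : ℝ => phase x t c) (2 * c ^ 2) t := fun c => by
    have := ((Complex.ofRealCLM.hasDerivAt (x := t)).const_mul (2 * c ^ 2)).const_add (c * x)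
    simpa [phase] using this
  rw [diagonal_pow]
  rintro (i | i) j
  · refine ((((h _).const_mul (-Complex.I)).cexp).mul_const (β j i)).congr_deriv ?_
    rw [Matrix.smul_apply, mul_diagonal]
    simp [Matrix.mul_apply, sigma3, Matrix.one_apply, Fintype.sum_sum_type, seedMatrix, seed]
    ring
  · refine (((h _).const_mul Complex.I).cexp).fun_neg.congr_deriv ?_
    rw [Matrix.smul_apply, mul_diagonal]
    simp [Matrix.mul_apply, sigma3, Fintype.sum_sum_type, seedMatrix, seed]
    ring

/-- The moments of the matrix of seed vectors. -/
def seedMoment (x t : ℝ) (m : ℕ) : Matrix (Fin n ⊕ Unit) (Fin n ⊕ Unit) ℂ :=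
  moment k (seedMatrix k β x t) m

variable {k} (him : ∀ j, 0 < (k j).im) (hk : Function.Injective k)
include him hk

lemma dressCoeff_seedList (x t : ℝ) : dressCoeff (seedList k β x t) = seedMoment k β x t 0 :=
  dressCoeff_eq_moment him hk fun _ => seed_ne_zero _ _ _ _

lemma entrySmooth_seedMoment (m : ℕ) :
    EntrySmooth fun z : ℝ × ℝ => seedMoment k β z.1 z.2 m :=
  entrySmooth_moment him hk (entrySmooth_seedMatrix k β) (fun _ _ => seed_ne_zero _ _ _ _) m

lemma hasEntryDerivAt_seedMoment_x (x t : ℝ) (m : ℕ) :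
    HasEntryDerivAt (fun x => seedMoment k β x t m)
      (-Complex.I • (sigma3 n * seedMoment k β x t (m + 1) - seedMoment k β x t (m + 1) * sigma3 n
        + seedMoment k β x t m *
          (sigma3 n * seedMoment k β x t 0 - seedMoment k β x t 0 * sigma3 n))) x := by
  have hs : EntrySmooth fun x => seedMatrix k β x t :=
    (entrySmooth_seedMatrix k β).comp (g := fun x => (x, t)) (contDiff_id.prodMk contDiff_const)
  have h0 : ∀ x j, (fun i => seedMatrix k β x t i j) ≠ 0 := fun x j => seed_ne_zero x t _ (β j)
  have h := hasEntryDerivAt_moment_x him hk hs h0 conjTranspose_sigma3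
    (hasEntryDerivAt_seedMatrix_x k β x t) m
  exact h

lemma hasEntryDerivAt_seedMoment_t (x t : ℝ) (m : ℕ) :
    HasEntryDerivAt (fun t => seedMoment k β x t m)
      (-(2 * Complex.I) • (sigma3 n * seedMoment k β x t (m + 2)
          - seedMoment k β x t (m + 2) * sigma3 n
        + seedMoment k β x t (m + 1) *
          (sigma3 n * seedMoment k β x t 0 - seedMoment k β x t 0 * sigma3 n)
        + seedMoment k β x t m *
          (sigma3 n * seedMoment k β x t 1 - seedMoment k β x t 1 * sigma3 n)
        + seedMoment k β x t m * seedMoment k β x t 0 *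
          (sigma3 n * seedMoment k β x t 0 - seedMoment k β x t 0 * sigma3 n))) t := by
  have hs : EntrySmooth fun t => seedMatrix k β x t :=
    (entrySmooth_seedMatrix k β).comp (g := fun t => (x, t)) (contDiff_const.prodMk contDiff_id)
  have h0 : ∀ t j, (fun i => seedMatrix k β x t i j) ≠ 0 := fun t j => seed_ne_zero x t _ (β j)
  have h := hasEntryDerivAt_moment_t him hk hs h0 conjTranspose_sigma3
    (hasEntryDerivAt_seedMatrix_t k β x t) m
  exact h

lemma hasEntryDerivAt_toBlocks₁₁_seedMoment (x t : ℝ) :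
    HasEntryDerivAt (fun x => (seedMoment k β x t 0).toBlocks₁₁)
      ((2 * Complex.I) • ((seedMoment k β x t 0).toBlocks₁₂ * (seedMoment k β x t 0).toBlocks₂₁)) x :=
  (hasEntryDerivAt_seedMoment_x β him hk x t 0).toBlocks₁₁.congr_deriv (by
    rw [toBlocks_mul_sigma3_commutator, sigma3_commutator, fromBlocks_add, fromBlocks_smul,
      toBlocks_fromBlocks₁₁]
    module)

lemma hasEntryDerivAt_toBlocks₁₂_seedMoment (x t : ℝ) (m : ℕ) :
    HasEntryDerivAt (fun x => (seedMoment k β x t m).toBlocks₁₂)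
      (-(2 * Complex.I) • ((seedMoment k β x t (m + 1)).toBlocks₁₂
        + (seedMoment k β x t m).toBlocks₁₁ * (seedMoment k β x t 0).toBlocks₁₂)) x :=
  (hasEntryDerivAt_seedMoment_x β him hk x t m).toBlocks₁₂.congr_deriv (by
    rw [toBlocks_mul_sigma3_commutator, sigma3_commutator, fromBlocks_add, fromBlocks_smul,
      toBlocks_fromBlocks₁₂]
    module)

lemma toBlocks₂₁_seedMoment (x t : ℝ) :
    (seedMoment k β x t 0).toBlocks₂₁ = -(seedMoment k β x t 0).toBlocks₁₂ᴴ := by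
  have h := conjTranspose_dressCoeff (seedList k β x t)
  rw [dressCoeff_seedList β him hk] at h
  ext i j
  have := congrFun (congrFun h (Sum.inr i)) (Sum.inl j)
  exact (neg_eq_iff_eq_neg.2 this).symm.trans (by simp; rfl)

lemma nSoliton_eq_toBlocks₁₂ (x t : ℝ) (i : Fin n) :
    nSoliton k β x t i = 2 * Complex.I * (seedMoment k β x t 0).toBlocks₁₂ i () := by
  rw [nSoliton_apply, dressCoeff_seedList β him hk]; rfl

theorem isVNLSSolution_nSoliton : IsVNLSSolution (nSoliton k β) := by
  refine ⟨?_, fun x t => ?_⟩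
  · rw [contDiff_pi]
    intro i
    simp only [nSoliton_eq_toBlocks₁₂ β him hk]
    exact contDiff_const.mul (entrySmooth_seedMoment β him hk 0 (Sum.inl i) (Sum.inr ()))
  have dx : ∀ y, HasDerivAt (fun y => nSoliton k β y t) (fun i => 2 * Complex.I *
      (-(2 * Complex.I) • ((seedMoment k β y t 1).toBlocks₁₂ + (seedMoment k β y t 0).toBlocks₁₁ *
        (seedMoment k β y t 0).toBlocks₁₂)) i ()) y := fun y => by
    rw [hasDerivAt_pi]
    intro i
    simp only [nSoliton_eq_toBlocks₁₂ β him hk]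
    exact (hasEntryDerivAt_toBlocks₁₂_seedMoment β him hk y t 0 i ()).const_mul _
  have dxx := ((hasEntryDerivAt_toBlocks₁₂_seedMoment β him hk x t 1).add
    ((hasEntryDerivAt_toBlocks₁₁_seedMoment β him hk x t).mul
      (hasEntryDerivAt_toBlocks₁₂_seedMoment β him hk x t 0))).smul (-(2 * Complex.I))
  have d2 := hasDerivAt_pi.2 fun i => (dxx i ()).const_mul (2 * Complex.I)
  have dt := hasDerivAt_pi.2 fun i =>
    ((hasEntryDerivAt_seedMoment_t β him hk x t 0).toBlocks₁₂ i ()).const_mul (2 * Complex.I)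
  have et : (fun s => nSoliton k β x s)
      = fun s i => 2 * Complex.I * (seedMoment k β x s 0).toBlocks₁₂ i () := by
    funext s i; exact nSoliton_eq_toBlocks₁₂ β him hk x s i
  rw [iteratedDeriv_succ, iteratedDeriv_one, funext fun y => (dx y).deriv, d2.deriv, et, dt.deriv]
  rw [toBlocks_mul_sigma3_commutator, toBlocks_mul_sigma3_commutator, toBlocks_mul_sigma3_commutator,
    sigma3_commutator]
  simp only [fromBlocks_add, fromBlocks_smul, toBlocks_fromBlocks₁₂, toBlocks₁₁_mul,
    toBlocks₂₁_seedMoment β him hk]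
  generalize (seedMoment k β x t 0).toBlocks₁₁ = A
  have hB : ∀ i, nSoliton k β x t i = 2 * Complex.I * (seedMoment k β x t 0).toBlocks₁₂ i () :=
    nSoliton_eq_toBlocks₁₂ β him hk x t
  generalize (seedMoment k β x t 0).toBlocks₁₂ = B at hB ⊢
  simp only [zero_add, one_add_one_eq_two]
  generalize (seedMoment k β x t 1).toBlocks₁₁ = A1
  generalize (seedMoment k β x t 1).toBlocks₁₂ = B1
  generalize (seedMoment k β x t 2).toBlocks₁₂ = B2
  have hI : Complex.I * Complex.I = -1 := Complex.I_mul_I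
  set X := -(2 * Complex.I) • ((2 : ℂ) • B2 + (2 : ℂ) • (A1 * B) + (2 : ℂ) • (A * B1)
    + (2 : ℂ) • ((A * A + B * -Bᴴ) * B)) with hX
  set Y := -(2 * Complex.I) • (-(2 * Complex.I) • (B2 + A1 * B) + ((2 * Complex.I) • (B * -Bᴴ) * B
    + A * -(2 * Complex.I) • (B1 + A * B))) with hY
  -- `X` and `Y` are the `t` and second `x` derivatives of `B`, where the field is `2iB`. All terms
  -- with higher moments or the block `A` cancel; what is left is the cubic term.
  have hXY : Complex.I • X + Y = -(8 : ℂ) • (B * (Bᴴ * B)) := by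
    simp only [hX, hY, Matrix.add_mul, Matrix.mul_add, Matrix.smul_mul, Matrix.mul_smul,
      Matrix.neg_mul, Matrix.mul_neg, Matrix.mul_assoc, smul_add, smul_neg, smul_smul]
    match_scalars <;>
      first | ring1 | linear_combination 8 * hI
  have hstar : star (nSoliton k β x t) ⬝ᵥ nSoliton k β x t = 4 * (Bᴴ * B) () () := by
    simp only [dotProduct, Pi.star_apply, hB, Matrix.mul_apply, conjTranspose_apply, Finset.mul_sum]
    refine Finset.sum_congr rfl fun i _ => ?_
    simp
    linear_combination (-4 * conj (B i ()) * B i ()) * hI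
  ext i
  have hi := congrFun (congrFun hXY i) ()
  simp only [Matrix.add_apply, Matrix.smul_apply, smul_eq_mul] at hi
  rw [Matrix.mul_apply, Fintype.sum_unique] at hi
  simp only [Pi.add_apply, Pi.smul_apply, smul_eq_mul, Pi.zero_apply, hstar, hB]
  simp only [PUnit.default_eq_unit] at hi
  linear_combination 2 * Complex.I * hi

end Equation

/-! ### Dressing by vectors on the coordinate blocks -/

section Blocks

open Topology

variable {ι : Type*} [Fintype ι] [DecidableEq ι]

/-- Only the lines of the vectors matter; this permits normalizing the seed vectors, which are
otherwise unbounded. -/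
lemma dress_map_smul {α : Type*} (k : α → ℂ) (v : α → ι → ℂ) {c : α → ℂ} (hc : ∀ m, c m ≠ 0)
    (l : List α) :
    dress (l.map fun m => (k m, c m • v m)) = dress (l.map fun m => (k m, v m)) := by
  have h : ∀ (D : ℂ → Matrix ι ι ℂ) m, dressStep D (k m, c m • v m) = dressStep D (k m, v m) := by
    intro D m
    funext z
    simp only [dressStep, dressFactor, mulVec_smul, scaleLine_smul (hc m)]
  simp only [dress_eq_foldl, List.foldl_map, h]

lemma dressCoeff_congr {L L' : List (ℂ × (ι → ℂ))} (h : dress L = dress L') :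
    dressCoeff L = dressCoeff L' :=
  tendsto_nhds_unique (tendsto_smul_one_sub_dress L) (h ▸ tendsto_smul_one_sub_dress L')

lemma dressCoeff_apply_eq_zero {L : List (ℂ × (ι → ℂ))} {i j : ι} (hij : i ≠ j)
    (h : ∀ z, dress L z i j = 0) : dressCoeff L i j = 0 := by
  have h1 := ((tendsto_smul_one_sub_dress L).apply_nhds i).apply_nhds j
  refine tendsto_nhds_unique h1 (tendsto_const_nhds.congr fun z => ?_)
  rw [Matrix.smul_apply, Matrix.sub_apply, h, Matrix.one_apply_ne hij, sub_zero, smul_zero]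

lemma scaleLine_sumElim_zero (c : ℂ) (w : ι → ℂ) :
    scaleLine c (Sum.elim w (fun _ : Unit => 0)) = fromBlocks (scaleLine c w) 0 0 1 := by
  ext (i | i) (j | j) <;>
    simp [scaleLine, lineProj, vecMulVec_apply, dotProduct, Fintype.sum_sum_type, Matrix.one_apply]

lemma scaleLine_zero_sumElim (c : ℂ) {e : ℂ} (he : e ≠ 0) :
    scaleLine c (Sum.elim (0 : ι → ℂ) (fun _ : Unit => e)) = fromBlocks 1 0 0 (of fun _ _ => c) := by
  have : conj e ≠ 0 := (map_ne_zero _).2 he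
  ext (i | i) (j | j) <;>
    simp [scaleLine, lineProj, vecMulVec_apply, dotProduct, Fintype.sum_sum_type, Matrix.one_apply]
  field_simp
  ring

end Blocks

/-! ### Separated configurations -/

namespace SolitonData

variable {n N : ℕ} (S : SolitonData n N)

/-- The data with the seed vectors replaced by `(a_m β_m, b_m)`. -/
def config (a b : Fin N → ℂ) (m : Fin N) : ℂ × (Fin n ⊕ Unit → ℂ) :=
  (S.k m, Sum.elim (a m • S.β m) fun _ => b m)

variable {a b : Fin N → ℂ}

lemma prod_blaschke_ne_zero {l : List (Fin N)} {j : Fin N} (hj : j ∉ l) :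
    (l.map fun m => blaschke (S.k m) (S.k j)).prod ≠ 0 := by
  refine List.prod_ne_zero ?_
  simp only [List.mem_map, not_exists, not_and]
  exact fun m hm => (S.generalPosition (ne_of_mem_of_not_mem hm hj)).blaschke_ne_zero

lemma dress_config_left {l : List (Fin N)} (hl : l.Nodup) (ha : ∀ m ∈ l, a m = 0)
    (hb : ∀ m ∈ l, b m ≠ 0) (z : ℂ) : dress (l.map (S.config a b)) z
      = fromBlocks 1 0 0 (of fun _ _ => (l.map fun m => blaschke (S.k m) z).prod) := by
  induction l using List.reverseRecOn generalizing z with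
  | nil =>
    have : (of fun _ _ => 1 : Matrix Unit Unit ℂ) = 1 := by ext; simp
    simp [this]
  | append_singleton l j ih =>
    have hnd := List.nodup_append.1 hl
    have hj : j ∉ l := fun h => hnd.2.2 j h j (by simp) rfl
    have ih' := ih hnd.1 (fun m hm => ha m (by simp [hm])) (fun m hm => hb m (by simp [hm]))
    have he : (dress (l.map (S.config a b)) (S.k j))ᴴ *ᵥ (S.config a b j).2
        = Sum.elim (0 : Fin n → ℂ) fun _ => conj (l.map fun m => blaschke (S.k m) (S.k j)).prod * b j := by
      rw [ih', fromBlocks_conjTranspose, config, fromBlocks_mulVec]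
      ext (i | i) <;> simp [ha j, mulVec, dotProduct]
    rw [List.map_append, List.map_singleton, dress_append_singleton]
    change dress _ z * dressFactor (S.k j) ((dress _ (S.k j))ᴴ *ᵥ _) z = _
    rw [he, dressFactor, scaleLine_zero_sumElim _ (mul_ne_zero ((map_ne_zero _).2
      (S.prod_blaschke_ne_zero hj)) (hb j (by simp))), ih', fromBlocks_multiply]
    congr 1
    · simp
    · simp
    · simp
    · ext; simp [Matrix.mul_apply]

/-- Solitons far to the left have their vectors in the last coordinate, those far to the right in
`ℂⁿ`. The two groups act on complementary blocks, the left one through scalar Blaschke factors only.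
-/
lemma dress_config_append {l l' : List (Fin N)} (hl : l.Nodup) (ha : ∀ m ∈ l, a m = 0)
    (hb : ∀ m ∈ l, b m ≠ 0) (ha' : ∀ m ∈ l', a m ≠ 0) (hb' : ∀ m ∈ l', b m = 0) (z : ℂ) :
    dress ((l ++ l').map (S.config a b)) z = fromBlocks (S.dressOn l' z) 0 0
      (of fun _ _ => (l.map fun m => blaschke (S.k m) z).prod) := by
  induction l' using List.reverseRecOn generalizing z with
  | nil => rw [List.append_nil, S.dress_config_left hl ha hb]; rfl
  | append_singleton l' j ih =>
    have ih' := ih (fun m hm => ha' m (by simp [hm])) (fun m hm => hb' m (by simp [hm]))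
    have he : (dress ((l ++ l').map (S.config a b)) (S.k j))ᴴ *ᵥ (S.config a b j).2
        = Sum.elim (a j • S.polVec l' j) fun _ => 0 := by
      rw [ih', fromBlocks_conjTranspose, config, fromBlocks_mulVec]
      have : Sum.elim (a j • S.β j) (fun _ => b j) ∘ (Sum.inl : Fin n → Fin n ⊕ Unit)
        = a j • S.β j := rfl
      rw [this, mulVec_smul]
      ext (i | i)
      · simp [polVec]
      · simp [hb' j, mulVec, dotProduct]
    rw [← List.append_assoc, List.map_append, List.map_singleton, dress_append_singleton]
    change dress _ z * dressFactor (S.k j) ((dress _ (S.k j))ᴴ *ᵥ _) z = _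
    rw [he, dressFactor, scaleLine_sumElim_zero, scaleLine_smul (ha' j (by simp)), ih',
      fromBlocks_multiply]
    congr 1
    · rw [dressOn, dressOn, List.map_append, List.map_singleton, dress_append_singleton]
      simp [dressFactor, polVec, dressOn]
    · simp
    · simp
    · simp

lemma dressCoeff_config_perm {l : List (Fin N)} (h : (List.finRange N).Perm l) :
    dressCoeff ((List.finRange N).map (S.config a b)) = dressCoeff (l.map (S.config a b)) := by
  refine dressCoeff_perm (h.map _) ?_ ?_
  · simp only [List.mem_map]
    rintro _ ⟨m, -, rfl⟩
    exact S.im_pos m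
  · rw [List.pairwise_map]
    exact (List.nodup_finRange N).imp fun h => S.k_injective.ne h

/-- In a configuration in which the vectors `(a_m β_m, b_m)`, with at most one exception, lie on
the coordinate blocks, in the order of the arrangement `σ`, the field reduces to a
superposition of one-solitons with the norming constants of `σ`. -/
lemma dressCoeff_config_apply (σ : Equiv.Perm (Fin N)) (h0 : ∀ j, a j ≠ 0 ∨ b j ≠ 0)
    (hsep : ∀ p q, p < q → a (σ p) = 0 ∨ b (σ q) = 0) (i : Fin n) :
    dressCoeff ((List.finRange N).map (S.config a b)) (Sum.inl i) (Sum.inr ())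
      = ∑ j, (S.k j - conj (S.k j)) *
        lineProj (Sum.elim (a j • S.norming σ j) fun _ : Unit => b j) (Sum.inl i) (Sum.inr ()) := by
  have hz : ∀ j, a j = 0 ∨ b j = 0 → (S.k j - conj (S.k j)) *
      lineProj (Sum.elim (a j • S.norming σ j) fun _ : Unit => b j) (Sum.inl i) (Sum.inr ()) = 0 := by
    intro j hj
    rcases hj with hj | hj <;> simp [lineProj, vecMulVec_apply, hj]
  have hzero : ∀ {l l' : List (Fin N)}, l.Nodup → (∀ m ∈ l, a m = 0) → (∀ m ∈ l, b m ≠ 0) →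
      (∀ m ∈ l', a m ≠ 0) → (∀ m ∈ l', b m = 0) →
      dressCoeff ((l ++ l').map (S.config a b)) (Sum.inl i) (Sum.inr ()) = 0 := by
    intro l l' hl ha hb ha' hb'
    refine dressCoeff_apply_eq_zero (by simp) fun z => ?_
    rw [S.dress_config_append hl ha hb ha' hb', fromBlocks_apply₁₂, Matrix.zero_apply]
  by_cases hint : ∃ j, a j ≠ 0 ∧ b j ≠ 0
  · obtain ⟨j, haj, hbj⟩ := hint
    have hleft : ∀ m, σ.symm m < σ.symm j → a m = 0 := fun m hm => by
      have := hsep _ _ hm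
      simp only [Equiv.apply_symm_apply] at this
      exact this.resolve_right hbj
    have hright : ∀ m, σ.symm j < σ.symm m → b m = 0 := fun m hm => by
      have := hsep _ _ hm
      simp only [Equiv.apply_symm_apply] at this
      exact this.resolve_left haj
    set l := (Finset.univ.filter fun m => m < σ.symm j).toList.map σ with hldef
    have hml : ∀ m, m ∈ l ↔ σ.symm m < σ.symm j := fun m => by
      simp only [hldef, List.mem_map, Finset.mem_toList, Finset.mem_filter, Finset.mem_univ, true_and]
      exact ⟨by rintro ⟨p, hp, rfl⟩; simpa using hp, fun h => ⟨_, h, by simp⟩⟩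
    have hl : l.Nodup := (Finset.nodup_toList _).map σ.injective
    have hjl : j ∉ l := by simp [hml]
    have hl' := nodup_rightOf σ j
    have hnd : (l ++ rightOf σ j).Nodup := List.nodup_append.2 ⟨hl, hl', by
      rintro m hm _ hm' rfl
      exact lt_asymm ((hml m).1 hm) ((mem_rightOf σ j m).1 hm')⟩
    have hperm : (List.finRange N).Perm (l ++ rightOf σ j ++ [j]) := by
      refine (List.perm_ext_iff_of_nodup (List.nodup_finRange N) ?_).2 fun m => ?_
      · refine List.nodup_append.2 ⟨hnd, by simp, ?_⟩
        rintro m hm _ hm' rfl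
        obtain rfl := List.mem_singleton.1 hm'
        rcases List.mem_append.1 hm with h | h
        · exact hjl h
        · simp [mem_rightOf] at h
      · simp only [List.mem_finRange, List.mem_append, List.mem_singleton, hml, mem_rightOf, true_iff]
        rcases lt_trichotomy (σ.symm m) (σ.symm j) with h | h | h
        · exact Or.inl (Or.inl h)
        · exact Or.inr (σ.symm.injective h)
        · exact Or.inl (Or.inr h)
    have hal : ∀ m ∈ l, a m = 0 := fun m hm => hleft m ((hml m).1 hm)
    have hbl : ∀ m ∈ l, b m ≠ 0 := fun m hm => (h0 m).resolve_left (by simp [hal m hm])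
    have hbr : ∀ m ∈ rightOf σ j, b m = 0 := fun m hm => hright m ((mem_rightOf σ j m).1 hm)
    have har : ∀ m ∈ rightOf σ j, a m ≠ 0 := fun m hm => (h0 m).resolve_right (by simp [hbr m hm])
    -- Soliton `j` is dressed last: everything before it is block diagonal and contributes nothing
    -- to this entry, so one projector remains.
    rw [Finset.sum_eq_single j (fun m _ hm => hz m ?_) (by simp), S.dressCoeff_config_perm hperm,
      List.map_append, List.map_singleton, dressCoeff_append_singleton, Matrix.add_apply,
      hzero hl hal hbl har hbr, zero_add, dressTerm]
    · set c := (l.map fun m => blaschke (S.k m) (S.k j)).prod with hc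
      have hc0 : conj c ≠ 0 := (map_ne_zero _).2 (S.prod_blaschke_ne_zero hjl)
      -- The left group multiplies the last coordinate of the dressed vector by `conj c`. Pulling
      -- this scalar out leaves `(conj c)⁻¹` on the first block, which is the Blaschke product in
      -- the norming constant.
      have hinv : ∏ m with m < σ.symm j, blaschke (S.k (σ m)) (conj (S.k j)) = (conj c)⁻¹ := by
        rw [hc, hldef, List.map_map, Finset.prod_map_toList, map_prod, ← Finset.prod_inv_distrib]
        refine Finset.prod_congr rfl fun m _ => ?_
        simp [blaschke]
      have he : (dress ((l ++ rightOf σ j).map (S.config a b)) (S.config a b j).1)ᴴ *ᵥ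
          (S.config a b j).2 = conj c • Sum.elim (a j • S.norming σ j) fun _ => b j := by
        change (dress _ (S.k j))ᴴ *ᵥ _ = _
        rw [S.dress_config_append hl hal hbl har hbr, fromBlocks_conjTranspose, config,
          fromBlocks_mulVec, S.norming_eq, hinv]
        have : Sum.elim (a j • S.β j) (fun _ => b j) ∘ (Sum.inl : Fin n → Fin n ⊕ Unit)
          = a j • S.β j := rfl
        rw [this, mulVec_smul]
        ext (i | i)
        · simp [polVec]
          field_simp
        · simp [mulVec, dotProduct, hc]
      rw [he, lineProj_smul hc0, Matrix.smul_apply]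
      rfl
    · rcases lt_trichotomy (σ.symm m) (σ.symm j) with h | h | h
      · exact Or.inl (hleft m h)
      · exact absurd (σ.symm.injective h) hm
      · exact Or.inr (hright m h)
  · push Not at hint
    rw [Finset.sum_eq_zero fun j _ => hz j (or_iff_not_imp_left.2 (hint j))]
    -- Every vector lies on a coordinate block, so the whole dressing factor is block diagonal and
    -- both sides vanish.
    have hperm : (List.finRange N).Perm ((Finset.univ.filter fun m => a m = 0).toList
        ++ (Finset.univ.filter fun m => a m ≠ 0).toList) := by
      refine (List.perm_ext_iff_of_nodup (List.nodup_finRange N) ?_).2 fun m => ?_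
      · refine List.nodup_append.2 ⟨Finset.nodup_toList _, Finset.nodup_toList _, ?_⟩
        rintro m hm _ hm' rfl
        simp only [Finset.mem_toList, Finset.mem_filter, Finset.mem_univ, true_and] at hm hm'
        exact hm' hm
      · simpa using em (a m = 0)
    rw [S.dressCoeff_config_perm hperm]
    have hm0 : ∀ m ∈ (Finset.univ.filter fun m => a m = 0).toList, a m = 0 := fun m hm => by
      simpa using hm
    have hm1 : ∀ m ∈ (Finset.univ.filter fun m => a m ≠ 0).toList, a m ≠ 0 := fun m hm => by
      simpa using hm
    exact hzero (Finset.nodup_toList _) hm0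
      (fun m hm => (h0 m).resolve_left (by simp [hm0 m hm])) hm1 (fun m hm => hint m (hm1 m hm))

end SolitonData

/-! ### Continuity of the residue -/

section Continuity

open Topology

variable {ι α : Type*} [Fintype ι] [DecidableEq ι] {N : ℕ} {k : Fin N → ℂ}

lemma tendsto_matrix_mul {m n p : Type*} [Fintype n] {l : Filter α} {A : α → Matrix m n ℂ}
    {B : α → Matrix n p ℂ} {A₀ : Matrix m n ℂ} {B₀ : Matrix n p ℂ} (hA : Tendsto A l (𝓝 A₀))
    (hB : Tendsto B l (𝓝 B₀)) : Tendsto (fun x => A x * B x) l (𝓝 (A₀ * B₀)) := by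
  refine tendsto_pi_nhds.2 fun i => tendsto_pi_nhds.2 fun j => ?_
  simp only [Matrix.mul_apply]
  exact tendsto_finsetSum _ fun r _ =>
    ((hA.apply_nhds i).apply_nhds r).mul ((hB.apply_nhds r).apply_nhds j)

lemma tendsto_matrix_inv {m : Type*} [Fintype m] [DecidableEq m] {l : Filter α}
    {M : α → Matrix m m ℂ} {M₀ : Matrix m m ℂ} (h : Tendsto M l (𝓝 M₀)) (h0 : IsUnit M₀) :
    Tendsto (fun p => (M p)⁻¹) l (𝓝 M₀⁻¹) := by
  have hd : M₀.det ≠ 0 := ((isUnit_iff_isUnit_det _).1 h0).ne_zero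
  simp only [Matrix.inv_def, Ring.inverse_eq_inv']
  exact (((continuous_id.matrix_det.tendsto M₀).comp h).inv₀ hd).smul
    ((continuous_id.matrix_adjugate.tendsto M₀).comp h)

/-- Continuity is read off from the closed form: `M` stays invertible at the limit as long as no
limit vector vanishes. -/
lemma tendsto_dressCoeff (him : ∀ j, 0 < (k j).im) (hk : Function.Injective k) {l : Filter α}
    {V : α → Matrix ι (Fin N) ℂ} {V₀ : Matrix ι (Fin N) ℂ} (h : Tendsto V l (𝓝 V₀))
    (hV : ∀ p j, (fun i => V p i j) ≠ 0) (hV₀ : ∀ j, (fun i => V₀ i j) ≠ 0) :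
    Tendsto (fun p => dressCoeff (List.ofFn fun j => (k j, fun i => V p i j))) l
      (𝓝 (dressCoeff (List.ofFn fun j => (k j, fun i => V₀ i j)))) := by
  simp only [dressCoeff_eq_moment him hk hV₀, fun p => dressCoeff_eq_moment him hk (hV p)]
  have hH : Tendsto (fun p => (V p)ᴴ) l (𝓝 V₀ᴴ) :=
    (continuous_id.matrix_conjTranspose.tendsto V₀).comp h
  have hM : Tendsto (fun p => cauchyGram k (V p)) l (𝓝 (cauchyGram k V₀)) := by
    refine tendsto_pi_nhds.2 fun i => tendsto_pi_nhds.2 fun j => ?_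
    exact (((tendsto_matrix_mul hH h).apply_nhds i).apply_nhds j).const_mul _
  exact tendsto_matrix_mul (tendsto_matrix_mul h tendsto_const_nhds)
    (tendsto_matrix_mul (tendsto_matrix_inv hM (isUnit_cauchyGram him hk hV₀)) hH)

end Continuity

/-! ### One-solitons -/

section OneSoliton

variable {n : ℕ}

/-- The real part `v (x + 2 u t)` of the exponent of a one-soliton with `k = (u + i v) / 2`. -/
def solitonExponent (k : ℂ) (x t : ℝ) : ℝ := 2 * k.im * (x + 4 * k.re * t)

/-- The phase of a one-soliton. -/
def solitonPhase (k : ℂ) (x t : ℝ) : ℝ := 2 * k.re * x + ((2 * k.re) ^ 2 - (2 * k.im) ^ 2) * t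

lemma phase_conj (k : ℂ) (x t : ℝ) :
    phase x t (conj k) = (solitonPhase k x t / 2 : ℝ) - (solitonExponent k x t / 2 : ℝ) * Complex.I := by
  apply Complex.ext <;>
    simp [phase, solitonPhase, solitonExponent, pow_two] <;> ring

lemma euclNorm_pos {b : Fin n → ℂ} (hb : b ≠ 0) : 0 < euclNorm b := by
  obtain ⟨i, hi⟩ := Function.ne_iff.1 hb
  refine Real.sqrt_pos.2 (Finset.sum_pos' (fun _ _ => by positivity) ⟨i, Finset.mem_univ _, ?_⟩)
  have : 0 < ‖b i‖ := norm_pos_iff.2 hi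
  positivity

lemma euclNorm_sq (b : Fin n → ℂ) : euclNorm b ^ 2 = ∑ i, ‖b i‖ ^ 2 :=
  Real.sq_sqrt (Finset.sum_nonneg fun _ _ => by positivity)

lemma oneSoliton_apply {k : ℂ} (hk : 0 < k.im) {b : Fin n → ℂ} (hb : b ≠ 0) (x t : ℝ) (i : Fin n) :
    oneSoliton k b x t i = Complex.exp (-Complex.I * (solitonPhase k x t : ℝ)) *
      ((4 * k.im / (Real.exp (solitonExponent k x t) + euclNorm b ^ 2 *
        Real.exp (-solitonExponent k x t)) : ℝ) * b i) := by
  have hB := euclNorm_pos hb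
  have e1 : 2 * k.im * (x + 2 * (2 * k.re) * t - Real.log (euclNorm b) / (2 * k.im))
      = solitonExponent k x t - Real.log (euclNorm b) := by
    rw [solitonExponent]; field_simp; ring
  -- Rewriting `cosh` in this way absorbs the logarithmic shift of the centre.
  have e2 : 2 * euclNorm b * Real.cosh (solitonExponent k x t - Real.log (euclNorm b))
      = Real.exp (solitonExponent k x t) + euclNorm b ^ 2 * Real.exp (-solitonExponent k x t) := by
    rw [Real.cosh_eq, neg_sub, Real.exp_sub, Real.exp_sub, Real.exp_log hB, Real.exp_neg]
    field_simp
  have hc := Real.cosh_pos (solitonExponent k x t - Real.log (euclNorm b))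
  rw [← e2]
  simp only [oneSoliton, e1, Pi.smul_apply, smul_eq_mul]
  have hB' : (euclNorm b : ℂ) ≠ 0 := by exact_mod_cast hB.ne'
  have hc' : ((Real.cosh (solitonExponent k x t - Real.log (euclNorm b)) : ℝ) : ℂ) ≠ 0 := by
    exact_mod_cast hc.ne'
  rw [solitonPhase]
  push_cast at hc' ⊢
  field_simp
  ring

lemma norm_exp_phase_conj (k : ℂ) (x t : ℝ) :
    ‖Complex.exp (-Complex.I * phase x t (conj k))‖ = Real.exp (-solitonExponent k x t / 2) := by
  rw [Complex.norm_exp, phase_conj]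
  congr 1
  simp; ring

lemma norm_exp_phase_conj' (k : ℂ) (x t : ℝ) :
    ‖Complex.exp (Complex.I * phase x t (conj k))‖ = Real.exp (solitonExponent k x t / 2) := by
  rw [Complex.norm_exp, phase_conj]
  congr 1
  simp

/-- The one-soliton in terms of its seed vector. -/
lemma oneSoliton_eq_lineProj {k : ℂ} (hk : 0 < k.im) {b : Fin n → ℂ} (hb : b ≠ 0) (x t : ℝ)
    (i : Fin n) : oneSoliton k b x t i = 2 * Complex.I * ((k - conj k) *
      lineProj (seed x t k b) (Sum.inl i) (Sum.inr ())) := by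
  rw [oneSoliton_apply hk hb]
  have n1 := norm_exp_phase_conj k x t
  have n2 := norm_exp_phase_conj' k x t
  have h4 : Complex.exp (-Complex.I * phase x t (conj k)) *
      conj (Complex.exp (Complex.I * phase x t (conj k)))
      = Complex.exp (-Complex.I * (solitonPhase k x t : ℝ)) := by
    rw [← Complex.exp_conj, ← Complex.exp_add, phase_conj]
    congr 1
    simp only [map_sub, map_mul, Complex.conj_ofReal, Complex.conj_I]
    push_cast
    ring
  have hs : star (seed x t k b) ⬝ᵥ seed x t k b = ((Real.exp (solitonExponent k x t)
      + euclNorm b ^ 2 * Real.exp (-solitonExponent k x t) : ℝ) : ℂ) := by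
    have h1 : Real.exp (solitonExponent k x t) = ‖Complex.exp (Complex.I * phase x t (conj k))‖ ^ 2 := by
      rw [n2, ← Real.exp_nat_mul]; congr 1; push_cast; ring
    have h2 : Real.exp (-solitonExponent k x t)
        = ‖Complex.exp (-Complex.I * phase x t (conj k))‖ ^ 2 := by
      rw [n1, ← Real.exp_nat_mul]; congr 1; push_cast; ring
    rw [euclNorm_sq, h1, h2]
    push_cast
    simp only [← Complex.conj_mul', dotProduct, Fintype.sum_sum_type, seed, Pi.star_apply, Sum.elim_inl,
      Sum.elim_inr, Fintype.sum_unique, Finset.sum_mul, Complex.star_def, map_mul, map_neg]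
    rw [add_comm]
    congr 1
    · ring
    · exact Finset.sum_congr rfl fun _ _ => by ring
  have hkk : k - conj k = 2 * k.im * Complex.I := by rw [Complex.sub_conj]; push_cast; ring
  rw [lineProj, Matrix.smul_apply, vecMulVec_apply, hs, hkk, ← h4]
  simp only [seed, Pi.star_apply, Sum.elim_inl, Sum.elim_inr, Complex.star_def, smul_eq_mul, map_neg]
  push_cast
  rw [div_eq_mul_inv]
  linear_combination (4 * k.im * (Complex.exp (solitonExponent k x t) + euclNorm b ^ 2 *
    Complex.exp (-solitonExponent k x t))⁻¹ * b i * Complex.exp (-Complex.I * phase x t (conj k)) *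
      conj (Complex.exp (Complex.I * phase x t (conj k)))) * Complex.I_mul_I

end OneSoliton

/-! ### The asymptotic states -/

section Asymptotics

open Topology

/-- The norm of the coefficients of a seed vector. -/
def ampNorm (k : ℂ) (x t : ℝ) : ℝ :=
  Real.sqrt (‖Complex.exp (-Complex.I * phase x t (conj k))‖ ^ 2
    + ‖Complex.exp (Complex.I * phase x t (conj k))‖ ^ 2)

/-- The normalized coefficients of a seed vector. -/
def ampPair (k : ℂ) (x t : ℝ) : ℂ × ℂ :=
  (Complex.exp (-Complex.I * phase x t (conj k)) / ampNorm k x t,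
    -Complex.exp (Complex.I * phase x t (conj k)) / ampNorm k x t)

lemma ampNorm_pos (k : ℂ) (x t : ℝ) : 0 < ampNorm k x t := by
  have : 0 < ‖Complex.exp (-Complex.I * phase x t (conj k))‖ := norm_pos_iff.2 (Complex.exp_ne_zero _)
  exact Real.sqrt_pos.2 (by positivity)

lemma seed_eq_smul {n : ℕ} (k : ℂ) (x t : ℝ) (b : Fin n → ℂ) :
    seed x t k b = (ampNorm k x t : ℂ) •
      Sum.elim ((ampPair k x t).1 • b) fun _ => (ampPair k x t).2 := by
  have h : (ampNorm k x t : ℂ) ≠ 0 := by exact_mod_cast (ampNorm_pos k x t).ne'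
  ext (i | i) <;> simp [seed, ampPair] <;> field_simp

lemma norm_ampPair (k : ℂ) (x t : ℝ) :
    ‖(ampPair k x t).1‖ ^ 2 + ‖(ampPair k x t).2‖ ^ 2 = 1 := by
  have h := ampNorm_pos k x t
  have h2 : ampNorm k x t ^ 2 = _ := Real.sq_sqrt (by positivity)
  simp only [ampPair, norm_div, norm_neg, Complex.norm_real, Real.norm_eq_abs, abs_of_pos h, div_pow]
  rw [← add_div, ← h2, div_self (by positivity)]

lemma norm_ampPair_fst_le (k : ℂ) (x t : ℝ) :
    ‖(ampPair k x t).1‖ ≤ Real.exp (-solitonExponent k x t) := by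
  have h : ‖Complex.exp (Complex.I * phase x t (conj k))‖ ≤ ampNorm k x t :=
    Real.le_sqrt_of_sq_le (by linarith [sq_nonneg ‖Complex.exp (-Complex.I * phase x t (conj k))‖])
  rw [norm_exp_phase_conj'] at h
  rw [ampPair, norm_div, norm_exp_phase_conj, Complex.norm_real, Real.norm_eq_abs,
    abs_of_pos (ampNorm_pos k x t), div_le_iff₀ (ampNorm_pos k x t)]
  refine le_trans (le_of_eq ?_) (mul_le_mul_of_nonneg_left h (Real.exp_pos _).le)
  rw [← Real.exp_add]; congr 1; ring

lemma norm_ampPair_snd_le (k : ℂ) (x t : ℝ) :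
    ‖(ampPair k x t).2‖ ≤ Real.exp (solitonExponent k x t) := by
  have h : ‖Complex.exp (-Complex.I * phase x t (conj k))‖ ≤ ampNorm k x t :=
    Real.le_sqrt_of_sq_le (by linarith [sq_nonneg ‖Complex.exp (Complex.I * phase x t (conj k))‖])
  rw [norm_exp_phase_conj] at h
  rw [ampPair, norm_div, norm_neg, norm_exp_phase_conj', Complex.norm_real, Real.norm_eq_abs,
    abs_of_pos (ampNorm_pos k x t), div_le_iff₀ (ampNorm_pos k x t)]
  refine le_trans (le_of_eq ?_) (mul_le_mul_of_nonneg_left h (Real.exp_pos _).le)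
  rw [← Real.exp_add]; congr 1; ring

lemma tendsto_lineProj {ι α : Type*} [Fintype ι] {l : Filter α} {v : α → ι → ℂ} {v₀ : ι → ℂ}
    (h : Tendsto v l (𝓝 v₀)) (h0 : v₀ ≠ 0) (i j : ι) :
    Tendsto (fun p => lineProj (v p) i j) l (𝓝 (lineProj v₀ i j)) := by
  have hs : ∀ i, Tendsto (fun p => star (v p i)) l (𝓝 (star (v₀ i))) := fun i =>
    (continuous_star.tendsto _).comp (h.apply_nhds i)
  have hd : Tendsto (fun p => star (v p) ⬝ᵥ v p) l (𝓝 (star v₀ ⬝ᵥ v₀)) :=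
    tendsto_finsetSum _ fun i _ => (hs i).mul (h.apply_nhds i)
  exact (hd.inv₀ (star_dotProduct_self_ne_zero h0)).mul ((h.apply_nhds i).mul (hs j))

lemma sumElim_smul_ne_zero {n : ℕ} {a b : ℂ} (hab : ‖a‖ ^ 2 + ‖b‖ ^ 2 = 1) {w : Fin n → ℂ}
    (hw : w ≠ 0) : Sum.elim (a • w) (fun _ : Unit => b) ≠ 0 := fun h => by
  have hb : b = 0 := congrFun h (Sum.inr ())
  obtain ⟨i, hi⟩ := Function.ne_iff.1 hw
  have ha : a * w i = 0 := congrFun h (Sum.inl i)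
  have ha' : a = 0 := (mul_eq_zero.1 ha).resolve_right hi
  simp [ha', hb] at hab

lemma tendsto_sumElim {n : ℕ} {α : Type*} {l : Filter α} {a b : α → ℂ} {a₀ b₀ : ℂ}
    (ha : Tendsto a l (𝓝 a₀)) (hb : Tendsto b l (𝓝 b₀)) (w : Fin n → ℂ) :
    Tendsto (fun p => Sum.elim (a p • w) (fun _ : Unit => b p)) l
      (𝓝 (Sum.elim (a₀ • w) (fun _ : Unit => b₀))) := by
  rw [tendsto_pi_nhds]
  rintro (i | i)
  · exact ha.mul_const (w i)
  · exact hb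

/-- For two solitons which move apart, one of the two is negligible. -/
lemma ampPair_limit {kj kl : ℂ} (hj : 0 < kj.im) (hl : 0 < kl.im) {U : Ultrafilter (ℝ × ℝ)}
    (hU : Tendsto (fun q : ℝ × ℝ => (kj.re - kl.re) * q.1) U atTop) {cj cl : ℂ × ℂ}
    (hcj : Tendsto (fun q : ℝ × ℝ => ampPair kj q.2 q.1) U (𝓝 cj))
    (hcl : Tendsto (fun q : ℝ × ℝ => ampPair kl q.2 q.1) U (𝓝 cl)) : cj.1 = 0 ∨ cl.2 = 0 := by
  -- The pair `q` is `(t, x)`, and `x = -2 (Re k_j + Re k_l) t` is the midpoint between the two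
  -- centres. The ultrafilter decides on which side of it `x` lies, hence which soliton is
  -- infinitely far away.
  rcases U.em fun q : ℝ × ℝ => 0 ≤ q.2 + 2 * (kj.re + kl.re) * q.1 with h | h
  · left
    have hy : Tendsto (fun q : ℝ × ℝ => solitonExponent kj q.2 q.1) U atTop := by
      refine tendsto_atTop_mono' _ ?_ (hU.const_mul_atTop (by positivity : 0 < 4 * kj.im))
      filter_upwards [h] with q hq
      have := mul_nonneg (by positivity : 0 ≤ 2 * kj.im) hq
      rw [solitonExponent]; linarith
    have h0 := squeeze_zero_norm (fun q : ℝ × ℝ => norm_ampPair_fst_le kj q.2 q.1)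
      (Real.tendsto_exp_neg_atTop_nhds_zero.comp hy)
    exact tendsto_nhds_unique ((continuous_fst.tendsto cj).comp hcj) h0
  · right
    have hy : Tendsto (fun q : ℝ × ℝ => solitonExponent kl q.2 q.1) U atBot := by
      refine tendsto_atBot_mono' _ ?_ (tendsto_neg_atTop_atBot.comp
        (hU.const_mul_atTop (by positivity : 0 < 4 * kl.im)))
      filter_upwards [h] with q hq
      have := mul_nonneg (by positivity : 0 ≤ 2 * kl.im) (neg_nonneg.2 (not_le.1 hq).le)
      simp only [Function.comp_apply, solitonExponent]; linarith
    have h0 := squeeze_zero_norm (fun q : ℝ × ℝ => norm_ampPair_snd_le kl q.2 q.1)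
      (Real.tendsto_exp_atBot.comp hy)
    exact tendsto_nhds_unique ((continuous_snd.tendsto cl).comp hcl) h0

end Asymptotics

namespace SolitonData

open Topology

variable {n N : ℕ} (S : SolitonData n N)

lemma field_apply_eq (x t : ℝ) (i : Fin n) : S.field x t i = 2 * Complex.I *
    dressCoeff ((List.finRange N).map (S.config (fun j => (ampPair (S.k j) x t).1)
      fun j => (ampPair (S.k j) x t).2)) (Sum.inl i) (Sum.inr ()) := by
  rw [field, nSoliton_apply]
  have h := dress_map_smul S.k (fun m => Sum.elim ((ampPair (S.k m) x t).1 • S.β m)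
    fun _ : Unit => (ampPair (S.k m) x t).2) (c := fun m => (ampNorm (S.k m) x t : ℂ))
    (fun m => by exact_mod_cast (ampNorm_pos (S.k m) x t).ne') (List.finRange N)
  simp only [← seed_eq_smul] at h
  rw [seedList, List.ofFn_eq_map, dressCoeff_congr h]
  rfl

/-- If the solitons are ordered as `σ` along the filter `l` of times, the asymptotic state of
the field is given by the norming constants of the arrangement `σ`. -/
theorem isAsymptoticState_norming (σ : Equiv.Perm (Fin N)) {l : Filter ℝ}
    (hl : ∀ p q, p < q → Tendsto (fun t => ((S.k (σ p)).re - (S.k (σ q)).re) * t) l atTop) :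
    IsAsymptoticState S.k S.field l (S.norming σ) := by
  refine ⟨S.norming_ne_zero σ, ?_⟩
  -- Uniformity in `x` becomes convergence along `l ×ˢ ⊤`, which is tested on ultrafilters; no decay
  -- estimate uniform in `x` is needed.
  rw [tendstoUniformly_iff_tendsto]
  suffices h : Tendsto (fun q : ℝ × ℝ => S.field q.2 q.1
      - ∑ j, oneSoliton (S.k j) (S.norming σ j) q.2 q.1) (l ×ˢ ⊤) (𝓝 0) by
    rw [nhds_eq_comap_uniformity, tendsto_comap_iff] at h
    exact h
  rw [tendsto_iff_ultrafilter]
  intro U hU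
  set G : ℝ × ℝ → Fin N → ℂ × ℂ := fun q j => ampPair (S.k j) q.2 q.1 with hG
  set K : Set (ℂ × ℂ) := {p | ‖p.1‖ ^ 2 + ‖p.2‖ ^ 2 = 1} with hK
  have hKc : IsCompact K := by
    refine Metric.isCompact_of_isClosed_isBounded
      (isClosed_eq (by fun_prop) continuous_const) ?_
    refine (Metric.isBounded_closedBall (x := (0 : ℂ × ℂ)) (r := 1)).subset fun p hp => ?_
    rw [mem_closedBall_zero_iff, Prod.norm_def, max_le_iff]
    have hp : ‖p.1‖ ^ 2 + ‖p.2‖ ^ 2 = 1 := hp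
    constructor <;> nlinarith [norm_nonneg p.1, norm_nonneg p.2]
  obtain ⟨L, hLK, hL⟩ := (isCompact_univ_pi fun _ : Fin N => hKc).ultrafilter_le_nhds (U.map G) (by
    rw [Ultrafilter.coe_map, le_principal_iff, mem_map]
    exact univ_mem' fun q j _ => norm_ampPair (S.k j) q.2 q.1)
  have hL' : Tendsto G U (𝓝 L) := hL
  have hn : ∀ j, ‖(L j).1‖ ^ 2 + ‖(L j).2‖ ^ 2 = 1 := fun j => hLK j (Set.mem_univ j)
  have h1 : ∀ j, Tendsto (fun q => (G q j).1) U (𝓝 (L j).1) := fun j =>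
    (continuous_fst.tendsto _).comp (hL'.apply_nhds j)
  have h2 : ∀ j, Tendsto (fun q => (G q j).2) U (𝓝 (L j).2) := fun j =>
    (continuous_snd.tendsto _).comp (hL'.apply_nhds j)
  have hfst : Tendsto Prod.fst (U : Filter (ℝ × ℝ)) l := tendsto_fst.mono_left hU
  -- The limit configuration is separated: for each pair of places one of the two vectors has
  -- degenerated.
  have hlim := S.dressCoeff_config_apply (a := fun j => (L j).1) (b := fun j => (L j).2) σ
    (fun j => by
      by_contra! h
      have := hn j
      simp [h.1, h.2] at this)
    (fun p q hpq => ampPair_limit (S.im_pos _) (S.im_pos _) ((hl p q hpq).comp hfst)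
      (hL'.apply_nhds _) (hL'.apply_nhds _))
  have hV : Tendsto (fun q => (of fun i j => (S.config (fun j => (G q j).1) (fun j => (G q j).2) j).2 i :
      Matrix (Fin n ⊕ Unit) (Fin N) ℂ)) U (𝓝 (of fun i j =>
        (S.config (fun j => (L j).1) (fun j => (L j).2) j).2 i)) := by
    refine tendsto_pi_nhds.2 fun i => tendsto_pi_nhds.2 fun j => ?_
    exact (tendsto_sumElim (h1 j) (h2 j) (S.β j)).apply_nhds i
  have hD := tendsto_dressCoeff S.im_pos S.k_injective hV
    (fun q j => sumElim_smul_ne_zero (norm_ampPair (S.k j) q.2 q.1) (S.β_ne_zero j))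
    (fun j => sumElim_smul_ne_zero (hn j) (S.β_ne_zero j))
  rw [tendsto_pi_nhds]
  intro i
  have hF : Tendsto (fun q : ℝ × ℝ => S.field q.2 q.1 i) U (𝓝 (2 * Complex.I * ∑ j,
      (S.k j - conj (S.k j)) * lineProj (Sum.elim ((L j).1 • S.norming σ j) fun _ : Unit => (L j).2)
        (Sum.inl i) (Sum.inr ()))) := by
    rw [← hlim]
    simp only [S.field_apply_eq, ← List.ofFn_eq_map]
    exact ((hD.apply_nhds (Sum.inl i)).apply_nhds (Sum.inr ())).const_mul _
  have hO : Tendsto (fun q : ℝ × ℝ => (∑ j, oneSoliton (S.k j) (S.norming σ j) q.2 q.1) i) U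
      (𝓝 (2 * Complex.I * ∑ j, (S.k j - conj (S.k j)) *
        lineProj (Sum.elim ((L j).1 • S.norming σ j) fun _ : Unit => (L j).2)
          (Sum.inl i) (Sum.inr ()))) := by
    simp only [Finset.sum_apply, Finset.mul_sum]
    refine tendsto_finsetSum _ fun j _ => ?_
    have hj := tendsto_lineProj (tendsto_sumElim (h1 j) (h2 j) (S.norming σ j))
      (sumElim_smul_ne_zero (hn j) (S.norming_ne_zero σ j)) (Sum.inl i) (Sum.inr ())
    refine ((hj.const_mul (S.k j - conj (S.k j))).const_mul (2 * Complex.I)).congr fun q => ?_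
    rw [oneSoliton_eq_lineProj (S.im_pos j) (S.norming_ne_zero σ j), seed_eq_smul]
    have hr : (ampNorm (S.k j) q.2 q.1 : ℂ) ≠ 0 := by exact_mod_cast (ampNorm_pos _ _ _).ne'
    rw [lineProj_smul hr]
  have := hF.sub hO
  rw [sub_self] at this
  exact this

end SolitonData

/-! ### Uniqueness of the asymptotic state -/

section Uniqueness

open Topology

variable {n N : ℕ}

lemma norm_oneSoliton_apply {k : ℂ} (hk : 0 < k.im) {b : Fin n → ℂ} (hb : b ≠ 0) (x t : ℝ)
    (i : Fin n) : ‖oneSoliton k b x t i‖ = 4 * k.im / (Real.exp (solitonExponent k x t) +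
      euclNorm b ^ 2 * Real.exp (-solitonExponent k x t)) * ‖b i‖ := by
  have hB := euclNorm_pos hb
  have e : -Complex.I * (solitonPhase k x t : ℝ) = ((-solitonPhase k x t : ℝ) : ℂ) * Complex.I := by
    push_cast; ring
  rw [oneSoliton_apply hk hb, norm_mul, norm_mul, e, Complex.norm_exp_ofReal_mul_I, one_mul,
    Complex.norm_real, Real.norm_of_nonneg (by positivity)]

/-- A one-soliton decays away from its centre. -/
lemma tendsto_oneSoliton_zero {α : Type*} {l : Filter α} {k : ℂ} (hk : 0 < k.im) {b : Fin n → ℂ}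
    (hb : b ≠ 0) {x t : α → ℝ} (h : Tendsto (fun a => solitonExponent k (x a) (t a)) l atTop ∨
      Tendsto (fun a => solitonExponent k (x a) (t a)) l atBot) (i : Fin n) :
    Tendsto (fun a => oneSoliton k b (x a) (t a) i) l (𝓝 0) := by
  have hB := euclNorm_pos hb
  rw [tendsto_zero_iff_norm_tendsto_zero]
  simp only [norm_oneSoliton_apply hk hb]
  have hden : Tendsto (fun a => Real.exp (solitonExponent k (x a) (t a)) +
      euclNorm b ^ 2 * Real.exp (-solitonExponent k (x a) (t a))) l atTop := by
    rcases h with h | h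
    · exact tendsto_atTop_mono (fun a => le_add_of_nonneg_right (by positivity))
        (Real.tendsto_exp_atTop.comp h)
    · exact tendsto_atTop_mono (fun a => le_add_of_nonneg_left (by positivity))
        ((Real.tendsto_exp_atTop.comp (tendsto_neg_atBot_atTop.comp h)).const_mul_atTop
          (by positivity : 0 < euclNorm b ^ 2))
  simpa using (hden.const_div_atTop (4 * k.im)).mul_const ‖b i‖

/-- The norming constant of a one-soliton is determined by the one-soliton. -/
lemma eq_of_amplitude_eq {b b' : Fin n → ℂ} (hb : b ≠ 0) (hb' : b' ≠ 0)
    (h : ∀ (y : ℝ) i, ((Real.exp y + euclNorm b ^ 2 * Real.exp (-y) : ℝ) : ℂ)⁻¹ * b i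
      = ((Real.exp y + euclNorm b' ^ 2 * Real.exp (-y) : ℝ) : ℂ)⁻¹ * b' i) : b = b' := by
  -- Substituting `s = e^{-2y}` turns the hypothesis into an identity of polynomials of degree one
  -- in `s`.
  have key : ∀ (s : ℝ), 0 < s → ∀ i, (1 + euclNorm b' ^ 2 * s : ℂ) * b i
      = (1 + euclNorm b ^ 2 * s : ℂ) * b' i := by
    intro s hs i
    have hB := euclNorm_pos hb
    have hB' := euclNorm_pos hb'
    have e : ∀ B : ℝ, Real.exp (-Real.log s / 2) + B ^ 2 * Real.exp (-(-Real.log s / 2))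
        = Real.exp (-Real.log s / 2) * (1 + B ^ 2 * s) := by
      intro B
      have : Real.exp (-(-Real.log s / 2)) = Real.exp (-Real.log s / 2) * s := by
        conv_rhs => rw [← Real.exp_log hs, Real.log_exp, ← Real.exp_add]
        congr 1; ring
      rw [this]; ring
    have h0 := h (-Real.log s / 2) i
    rw [e, e] at h0
    have p1 : ((1 + euclNorm b ^ 2 * s : ℝ) : ℂ) ≠ 0 := by
      exact_mod_cast (by positivity : 0 < 1 + euclNorm b ^ 2 * s).ne'
    have p2 : ((1 + euclNorm b' ^ 2 * s : ℝ) : ℂ) ≠ 0 := by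
      exact_mod_cast (by positivity : 0 < 1 + euclNorm b' ^ 2 * s).ne'
    have p3 : ((Real.exp (-Real.log s / 2) : ℝ) : ℂ) ≠ 0 := by
      exact_mod_cast (Real.exp_pos _).ne'
    rw [Complex.ofReal_mul, Complex.ofReal_mul] at h0
    push_cast at h0 p1 p2 p3
    rw [mul_comm (euclNorm b' ^ 2 : ℂ)] at p2
    field_simp at h0
    linear_combination h0
  ext i
  have h1 := key 1 one_pos i
  have h2 := key 2 two_pos i
  push_cast at h1 h2
  -- Twice the value at `1` minus the value at `2` is the constant coefficient.
  linear_combination 2 * h1 - h2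

lemma IsAsymptoticState.unique {k : Fin N → ℂ} {q : ℝ → ℝ → Fin n → ℂ} {l : Filter ℝ} [l.NeBot]
    {b b' : Fin N → Fin n → ℂ} (hk : ∀ j, 0 < (k j).im)
    (hl : ∀ j m, m ≠ j → Tendsto (fun t => ((k m).re - (k j).re) * t) l atTop ∨
      Tendsto (fun t => ((k m).re - (k j).re) * t) l atBot)
    (h : IsAsymptoticState k q l b) (h' : IsAsymptoticState k q l b') : b = b' := by
  funext j
  refine eq_of_amplitude_eq (h.1 j) (h'.1 j) fun y i => ?_
  -- Motion along with soliton `j`: its exponent stays equal to `y`, while those of the other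
  -- solitons tend to `±∞`.
  set x : ℝ → ℝ := fun t => y / (2 * (k j).im) - 4 * (k j).re * t with hx
  have hlim : ∀ {c : Fin N → Fin n → ℂ}, IsAsymptoticState k q l c →
      Tendsto (fun t => q (x t) t i - ∑ m, oneSoliton (k m) (c m) (x t) t i) l (𝓝 0) := by
    intro c hc
    have h1 := hc.2
    rw [Metric.tendstoUniformly_iff] at h1
    rw [Metric.tendsto_nhds]
    intro ε hε
    filter_upwards [h1 ε hε] with t ht
    have h2 := ht (x t)
    rw [dist_comm] at h2
    refine lt_of_le_of_lt ?_ h2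
    simpa using dist_le_pi_dist (q (x t) t - ∑ m, oneSoliton (k m) (c m) (x t) t) 0 i
  have hdecay : ∀ {c : Fin N → Fin n → ℂ}, (∀ m, c m ≠ 0) →
      Tendsto (fun t => ∑ m ∈ Finset.univ.erase j, oneSoliton (k m) (c m) (x t) t i) l (𝓝 0) := by
    intro c hc
    rw [← Finset.sum_const_zero (s := Finset.univ.erase j)]
    refine tendsto_finsetSum _ fun m hm => ?_
    have he : ∀ t, solitonExponent (k m) (x t) t = 2 * (k m).im * (y / (2 * (k j).im))
        + 8 * (k m).im * (((k m).re - (k j).re) * t) := fun t => by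
      simp only [solitonExponent, hx]; ring
    have hp : 0 < 8 * (k m).im := by have := hk m; positivity
    refine tendsto_oneSoliton_zero (hk m) (hc m) ?_ i
    simp only [he]
    exact (hl j m (Finset.ne_of_mem_erase hm)).imp
      (fun H => tendsto_atTop_add_const_left _ _ (H.const_mul_atTop hp))
      fun H => tendsto_atBot_add_const_left _ _ (H.const_mul_atBot hp)
  have hd : Tendsto (fun t => oneSoliton (k j) (b j) (x t) t i - oneSoliton (k j) (b' j) (x t) t i)
      l (𝓝 0) := by
    have := ((hlim h').sub (hlim h)).sub ((hdecay h.1).sub (hdecay h'.1))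
    simp only [sub_zero] at this
    refine this.congr fun t => ?_
    rw [← Finset.add_sum_erase _ _ (Finset.mem_univ j), ← Finset.add_sum_erase _ _ (Finset.mem_univ j)]
    ring
  have hy : ∀ t, solitonExponent (k j) (x t) t = y := fun t => by
    have := (hk j).ne'
    simp only [solitonExponent, hx]; field_simp; ring
  set B := Real.exp y + euclNorm (b j) ^ 2 * Real.exp (-y)
  set B' := Real.exp y + euclNorm (b' j) ^ 2 * Real.exp (-y)
  -- The two candidates share the oscillating phase, so their difference has constant modulus along
  -- the path and can tend to zero only by vanishing.
  have hn : ∀ t, ‖oneSoliton (k j) (b j) (x t) t i - oneSoliton (k j) (b' j) (x t) t i‖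
      = 4 * (k j).im * ‖(B : ℂ)⁻¹ * b j i - (B' : ℂ)⁻¹ * b' j i‖ := fun t => by
    have e : -Complex.I * (solitonPhase (k j) (x t) t : ℝ)
        = ((-solitonPhase (k j) (x t) t : ℝ) : ℂ) * Complex.I := by push_cast; ring
    rw [oneSoliton_apply (hk j) (h.1 j), oneSoliton_apply (hk j) (h'.1 j), hy, ← mul_sub, norm_mul,
      e, Complex.norm_exp_ofReal_mul_I, one_mul]
    have h4 : ‖((4 * (k j).im : ℝ) : ℂ)‖ = 4 * (k j).im := by
      have := hk j
      rw [Complex.norm_real, Real.norm_of_nonneg (by positivity)]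
    rw [← h4, ← norm_mul, h4, Complex.ofReal_div, Complex.ofReal_div]
    congr 1
    ring
  have h0 := hd.norm
  simp only [hn, norm_zero] at h0
  have h1 := tendsto_nhds_unique h0 tendsto_const_nhds
  have h2 := (mul_eq_zero.1 h1.symm).resolve_left (by have := hk j; positivity)
  exact sub_eq_zero.1 (norm_eq_zero.1 h2)

end Uniqueness

namespace SolitonData

variable {n N : ℕ} (S : SolitonData n N)

/-- If the solitons are ordered as `σ` along the filter `l` of times, the norming constants of the
arrangement `σ` are the only asymptotic state of the field. -/
theorem isAsymptoticState_iff (σ : Equiv.Perm (Fin N)) {l : Filter ℝ} [l.NeBot]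
    (hl : ∀ p q, p < q → Tendsto (fun t => ((S.k (σ p)).re - (S.k (σ q)).re) * t) l atTop)
    (b : Fin N → Fin n → ℂ) : IsAsymptoticState S.k S.field l b ↔ b = S.norming σ := by
  have hS := S.isAsymptoticState_norming σ hl
  refine ⟨fun h => h.unique S.im_pos (fun j m hmj => ?_) hS, fun h => h ▸ hS⟩
  obtain ⟨p, rfl⟩ := σ.surjective j
  obtain ⟨q, rfl⟩ := σ.surjective m
  rcases lt_or_gt_of_ne (fun h => hmj (congrArg σ h) : q ≠ p) with h | h
  · exact Or.inl (hl q p h)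
  · refine Or.inr ((tendsto_neg_atTop_atBot.comp (hl p q h)).congr fun t => ?_)
    simp only [Function.comp_apply]; ring

theorem isAsymptoticState_atBot_iff (b : Fin N → Fin n → ℂ) :
    IsAsymptoticState S.k S.field atBot b ↔ b = S.norming 1 :=
  S.isAsymptoticState_iff 1 (fun _ _ h =>
    tendsto_id.const_mul_atBot_of_neg (sub_neg.2 (S.re_strictMono h))) b

theorem isAsymptoticState_atTop_iff (b : Fin N → Fin n → ℂ) :
    IsAsymptoticState S.k S.field atTop b ↔ b = S.norming Fin.revPerm :=
  S.isAsymptoticState_iff Fin.revPerm (fun _ _ h =>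
    tendsto_id.const_mul_atTop (sub_pos.2 (S.re_strictMono (Fin.rev_lt_rev.2 h)))) b

end SolitonData

end

end Manakov

theorem theorem2p2 (n : ℕ) :
    -- the collision map is a reversible parametric Yang-Baxter map
    (Manakov.IsParametricYangBaxterMap Manakov.GeneralPosition (Manakov.collisionMap n) ∧
      Manakov.IsReversible Manakov.GeneralPosition (Manakov.collisionMap n)) ∧
    ∀ (N : ℕ) (S : Manakov.SolitonData n N),
      -- the field solves the equation and does not depend on the order of the dressing
      Manakov.IsVNLSSolution S.field ∧
      (∀ τ : Equiv.Perm (Fin N), Manakov.nSoliton (S.k ∘ τ) (S.β ∘ τ) = S.field) ∧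
      -- its asymptotic states before and after the `N`-soliton collision
      (∀ b, Manakov.IsAsymptoticState S.k S.field Filter.atBot b ↔ b = S.norming 1) ∧
      (∀ b, Manakov.IsAsymptoticState S.k S.field Filter.atTop b ↔ b = S.norming Fin.revPerm) ∧
      -- every pairwise collision acts on the polarizations through the collision map
      (∀ (σ : Equiv.Perm (Fin N)) (a b : Fin N), (b : ℕ) = a + 1 → σ a < σ b →
        S.pol (σ * Equiv.swap a b) = S.collide (S.pol σ) (σ a, σ b)) ∧
      -- pairwise collisions may take place in any order
      (∀ (σ : Equiv.Perm (Fin N)) (L : List (Fin N × Fin N)), Manakov.CollisionHistory σ L →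
        ∃ L', Manakov.CollisionHistory Fin.revPerm (L ++ L')) ∧
      -- in any order, there are `N choose 2` of them, one for each pair, and their composition
      -- maps the initial to the final polarizations
      ∀ L : List (Fin N × Fin N), Manakov.CollisionHistory Fin.revPerm L →
        L.length = N.choose 2 ∧ L.Nodup ∧ (∀ j l, (j, l) ∈ L ↔ j < l) ∧
        L.foldl S.collide (S.pol 1) = S.pol Fin.revPerm := by
  exact ⟨⟨Manakov.isParametricYangBaxterMap_collisionMap n, Manakov.isReversible_collisionMap n⟩,
    fun _ S => ⟨Manakov.isVNLSSolution_nSoliton S.β S.im_pos S.k_injective,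
      Manakov.nSoliton_comp_perm S, S.isAsymptoticState_atBot_iff, S.isAsymptoticState_atTop_iff,
      fun σ a b hab _ => S.pol_mul_swap σ a b hab, fun _ _ h => h.exists_complete,
      fun _ h => ⟨h.length_of_complete, h.nodup, h.mem_iff_of_complete, h.foldl_collide S⟩⟩⟩
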